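/- **Setup.** Let $(e_0,\dots,e_n)$ be a dimension vector of non-negative integers. The group $\prod_i \mathrm{GL}(e_i)$ acts on $V=\bigoplus_{i=1}^n\mathrm{Hom}(\mathbb C^{e_{i-1}},\mathbb C^{e_i})$. An orbit $r$ is given by its rank conditions $r_{ij}$ ($0\le i\le j\le n$), the rank of the composed map $\mathbb C^{e_i}\to\mathbb C^{e_j}$ for any point of the orbit; $r_{ii}=e_i$. Put $s_{ij}=r_{ij}-r_{i-1,j}-r_{i,j+1}+r_{i-1,j+1}$, where terms with an index outside $0,\dots,n$ are zero. **Lace diagrams.** A lace diagram consists of columns $0,\dots,n$ with $e_i$ dots in column $i$, numbered from top to bottom, each dot being connected to at most one dot in each neighbouring column. It is identified with the sequence of permutations $(w_1,\dots,w_n)$ in which $w_i$ has all descent positions $\le e_i$, $w_i^{-1}$ has all descent positions $\le e_{i-1}$, and $w_i(q)=p$ (for $q\le e_i$, $p\le e_{i-1}$) exactly when dot $q$ of column $i$ is connected to dot $p$ of column $i-1$. The left-most lace diagram of $r$ is obtained from the empty diagram by adding, for $i=0,\dots,n$ and for $j=n,n-1,\dots,i$, in this order, $s_{ij}$ strands from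 column $i$ to column $j$ at the bottom. **KMS-factorizations.** Let $N=e_0+\dots+e_n$. Divide $N\times N$ matrices into block rows $0,\dots,n$ from top to bottom and block columns $n,\dots,0$ from left to right, block row $j$ having $e_j$ rows and block column $i$ having $e_i$ columns. The Zelevinsky permutation $v(r)\in S_N$ is the one whose matrix (entries $1$ at $(p,v(p))$) has in block row $j$ and block column $i$ exactly $s_{ij}$ non-zero entries if $i\le j$, exactly $r_{j,j+1}$ if $i=j+1$, and none if $i\ge j+2$, the non-zero entries of each block row and of each block column proceeding from north-west to south-east. Let $*$ denote the Hecke (Demazure) product, the associative product on permutations with $u*s_k=us_k$ if $\ell(us_k)>\ell(u)$ and $u*s_k=u$ otherwise, where $s_k$ is the transposition $(k\ k+1)$. For $0\le j<j+2\le i\le n$ let $m=e_{j+1}+\dots+e_{i-1}$ and let $R_{j,i}$ be the permutation with $R_{j,i}(m+k)=m+k+e_j$ for $1\le k\le e_i$ and $R_{j,i}(m+e_i+k)=m+k$ for $1\le k\le e_j$, fixing all other numbers. A KMS-factorization for $r$ is a sequence $(w_1,\dots,w_n)$ with $w_i\in S_{e_{i-1}+e_i}$ such that $$w_1*R_{0,2}*R_{0,3}*\cdots*R_{0,n}*w_2*R_{1,3}*\cdots*R_{1,n}*w_3*\cdots*w_n=w_0\,v(r)\,w_0,$$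 where $w_0$ is the longest element of $S_N$. **Moves.** Given a sequence $u=(u_1,\dots,u_n)$ of permutations and integers $1\le i<n$, $1\le j<e_i$ with $u_i(j)<u_i(j+1)$ and $u_{i+1}^{-1}(j)<u_{i+1}^{-1}(j+1)$, the three-term move exchanges any of those of $$(\dots,u_is_j,u_{i+1},\dots)\longleftrightarrow(\dots,u_i,s_ju_{i+1},\dots)\longleftrightarrow(\dots,u_is_j,s_ju_{i+1},\dots)$$ that are lace diagrams for $(e_0,\dots,e_n)$. **Theorem.** For every orbit $r$ the left-most lace diagram exists and is unique as a sequence of permutations, and a sequence $(w_1,\dots,w_n)$ of permutations is a KMS-factorization for $r$ if and only if it can be obtained from the left-most lace diagram of $r$ by a finite (possibly empty) series of three-term moves. -/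

import Mathlib

namespace KMS

open Equiv

/-! ### Quiver representations and rank conditions

Columns are numbered `0, …, n` and `e i` is the number of dots in column `i` (the dimension of the
`i`-th vector space).  Only the values `e 0, …, e n` and the maps `φ 0, …, φ (n - 1)` ever matter.
Dots, rows and permutation entries are counted from `0`. -/

/-- A sequence of linear maps `ℂ^(e 0) → ℂ^(e 1) → ℂ^(e 2) → ⋯`; the map out of vertex `i` is
`φ i`. -/
abbrev QuiverRep (e : ℕ → ℕ) : Type :=
  ∀ i : ℕ, (Fin (e i) → ℂ) →ₗ[ℂ] (Fin (e (i + 1)) → ℂ)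

/-- The composed map from vertex `i` to vertex `i + k` (the identity if `k = 0`). -/
def QuiverRep.comp {e : ℕ → ℕ} (φ : QuiverRep e) (i : ℕ) :
    ∀ k : ℕ, (Fin (e i) → ℂ) →ₗ[ℂ] (Fin (e (i + k)) → ℂ)
  | 0 => LinearMap.id
  | k + 1 => (φ (i + k)).comp (QuiverRep.comp φ i k)

/-- `r` is the array of rank conditions `r i j`, `0 ≤ i ≤ j ≤ n`, of an orbit of quiver
representations with dimension vector `(e 0, …, e n)`: there is a point `φ` of the representation
space such that `r i j` is the rank of the map from vertex `i` to vertex `j` (so `r i i = e i`). -/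
def IsOrbit (n : ℕ) (e : ℕ → ℕ) (r : ℕ → ℕ → ℕ) : Prop :=
  ∃ φ : QuiverRep e, ∀ i j : ℕ, i ≤ j → j ≤ n →
    r i j = Module.finrank ℂ (LinearMap.range (φ.comp i (j - i)))

/-- `r i j`, read as `0` when `j` exceeds `n`. -/
def rk (n : ℕ) (r : ℕ → ℕ → ℕ) (i j : ℕ) : ℕ :=
  if j ≤ n then r i j else 0

/-- `r (i - 1) j`, read as `0` when `i = 0` or `j` exceeds `n`. -/
def rkPred (n : ℕ) (r : ℕ → ℕ → ℕ) : ℕ → ℕ → ℕ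
  | 0, _ => 0
  | i + 1, j => rk n r i j

/-- The number `r i j - r (i-1) j - r i (j+1) + r (i-1) (j+1)` of strands that start at column `i`
and terminate at column `j`.  For an orbit this number is non-negative, so that nothing is lost in
the natural number subtraction. -/
def strandCount (n : ℕ) (r : ℕ → ℕ → ℕ) (i j : ℕ) : ℕ :=
  (rk n r i j + rkPred n r i (j + 1)) - (rkPred n r i j + rk n r i (j + 1))

/-! ### Lace diagrams

A lace diagram is identified with the sequence of permutations of its extended diagram.  The
permutation `w i`, for `i : Fin n`, describes the connections from column `i + 1` to column `i`:
`w i q = p` when dot `q` of column `i + 1` is connected to dot `p` of column `i`. -/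

/-- `u` is a partial permutation from `a` elements to `b` elements: a finitely supported permutation
such that all descent positions of `u` are at most `a` and all descent positions of `u⁻¹` are at
most `b` (descent positions being counted from one). -/
def IsPartialPerm (a b : ℕ) (u : Perm ℕ) : Prop :=
  (∃ N, ∀ k, N ≤ k → u k = k) ∧
    (∀ k, a ≤ k → u k < u (k + 1)) ∧ (∀ k, b ≤ k → u⁻¹ k < u⁻¹ (k + 1))

/-- The sequence `w` is a lace diagram for the dimension vector `(e 0, …, e n)`. -/
def IsLaceDiagram (n : ℕ) (e : ℕ → ℕ) (w : Fin n → Perm ℕ) : Prop :=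
  ∀ i : Fin n, IsPartialPerm (e (i + 1)) (e i) (w i)

/-- The strands of the left-most lace diagram in the order in which they are added (from top to
bottom), a strand from column `i` to column `j` being recorded as `(i, j)`:
for `i = 0, 1, …, n` and for `j = n, n - 1, …, i` there are `strandCount n r i j` of them. -/
def strandList (n : ℕ) (r : ℕ → ℕ → ℕ) : List (ℕ × ℕ) :=
  (List.range (n + 1)).flatMap fun i =>
    (List.range' i (n + 1 - i)).reverse.flatMap fun j =>
      List.replicate (strandCount n r i j) (i, j)

/-- The row, in column `k`, of the dot of strand number `t` of the list `L`: the number of earlier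
strands that meet column `k`. -/
def dotRow (L : List (ℕ × ℕ)) (t k : ℕ) : ℕ :=
  (L.take t).countP fun s => decide (s.1 ≤ k ∧ k ≤ s.2)

/-- Dot `q` of column `i + 1` is connected to dot `p` of column `i` in the left-most lace
diagram. -/
def LeftmostConnected (n : ℕ) (r : ℕ → ℕ → ℕ) (i q p : ℕ) : Prop :=
  ∃ t : Fin (strandList n r).length,
    ((strandList n r).get t).1 ≤ i ∧ i + 1 ≤ ((strandList n r).get t).2 ∧
      q = dotRow (strandList n r) t (i + 1) ∧ p = dotRow (strandList n r) t i

/-- `w` is the left-most lace diagram for the orbit `r`. -/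
def IsLeftmost (n : ℕ) (e : ℕ → ℕ) (r : ℕ → ℕ → ℕ) (w : Fin n → Perm ℕ) : Prop :=
  IsLaceDiagram n e w ∧
    ∀ (i : Fin n) (q p : ℕ), q < e (i + 1) → p < e i →
      (w i q = p ↔ LeftmostConnected n r i q p)

/-! ### The three-term moves -/

/-- The simple transposition of `k` and `k + 1`. -/
def simpleSwap (k : ℕ) : Perm ℕ := swap k (k + 1)

/-- With `i' = i + 1`, the diagram `w` is one of the three diagrams
`(…, u i * s, u i', …)`, `(…, u i, s * u i', …)`, `(…, u i * s, s * u i', …)`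
where `s = simpleSwap j`: two strands through dots `j` and `j + 1` of column `i + 1` are made to
cross just to the left of this column, just to the right of it, or on both sides. -/
def InTriple {n : ℕ} (u : Fin n → Perm ℕ) (i i' : Fin n) (j : ℕ) (w : Fin n → Perm ℕ) : Prop :=
  w = Function.update u i (u i * simpleSwap j) ∨
  w = Function.update u i' (simpleSwap j * u i') ∨
  w = Function.update (Function.update u i (u i * simpleSwap j)) i' (simpleSwap j * u i')

/-- The lace diagrams `w` and `w'` are exchanged by a three-term move: for two consecutive
dots `j`, `j + 1` of a column strictly between the first and the last one, both belong to the triple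
of some `u` in which the strands through these two dots cross on neither side of the column. -/
def KMove (n : ℕ) (e : ℕ → ℕ) (w w' : Fin n → Perm ℕ) : Prop :=
  IsLaceDiagram n e w ∧ IsLaceDiagram n e w' ∧
    ∃ (i i' : Fin n) (j : ℕ) (u : Fin n → Perm ℕ),
      (i' : ℕ) = i + 1 ∧ j + 1 < e i' ∧
      u i j < u i (j + 1) ∧ (u i')⁻¹ j < (u i')⁻¹ (j + 1) ∧
      InTriple u i i' j w ∧ InTriple u i i' j w'

/-! ### Hecke products -/

/-- `a` is a reduced word for `u`. -/
def IsReducedWord (a : List ℕ) (u : Perm ℕ) : Prop :=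
  (a.map simpleSwap).prod = u ∧
    ∀ b : List ℕ, (b.map simpleSwap).prod = u → a.length ≤ b.length

/-- Right multiplication of `u` by a simple transposition in the degenerate Hecke (0-Hecke)
monoid: the product is `u * s` if this is longer than `u`, and `u` otherwise. -/
def heckeStep (u : Perm ℕ) (k : ℕ) : Perm ℕ :=
  if u k < u (k + 1) then u * simpleSwap k else u

/-- `z` is the Hecke (Demazure) product of the permutations in the list `us`. -/
def IsHeckeProduct (us : List (Perm ℕ)) (z : Perm ℕ) : Prop :=
  ∃ words : List (List ℕ), List.Forall₂ IsReducedWord words us ∧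
    words.flatten.foldl heckeStep 1 = z

/-! ### The Zelevinsky permutation and KMS-factorizations -/

/-- The total dimension `e 0 + ⋯ + e n`. -/
def totalDim (n : ℕ) (e : ℕ → ℕ) : ℕ := ∑ i ∈ Finset.range (n + 1), e i

/-- Block rows are numbered `0, 1, …, n` from top to bottom, block row `j` having `e j` rows. -/
def InBlockRow (e : ℕ → ℕ) (j p : ℕ) : Prop :=
  (∑ k ∈ Finset.range j, e k) ≤ p ∧ p < ∑ k ∈ Finset.range (j + 1), e k

/-- Block columns are numbered `n, …, 1, 0` from left to right, block column `i` having `e i`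
columns. -/
def InBlockCol (n : ℕ) (e : ℕ → ℕ) (i q : ℕ) : Prop :=
  (∑ k ∈ Finset.Ioc i n, e k) ≤ q ∧ q < ∑ k ∈ Finset.Icc i n, e k

open Classical in
/-- `v` is the Zelevinsky permutation of the orbit `r`.  Its permutation matrix, with an entry in
row `p` and column `v p`, has in block row `j` and block column `i` as many non-zero entries as there
are strands from column `i` to column `j` if `i ≤ j`; it has `r j (j + 1)` of them if `i = j + 1`
and none if `i ≥ j + 2`; the non-zero entries of each block row and of each block column proceed
from north-west to south-east. -/
def IsZelevinsky (n : ℕ) (e : ℕ → ℕ) (r : ℕ → ℕ → ℕ) (v : Perm (Fin (totalDim n e))) : Prop :=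
  (∀ j i : ℕ, j ≤ n → i ≤ n →
    (Finset.univ.filter fun p : Fin (totalDim n e) =>
        InBlockRow e j p ∧ InBlockCol n e i (v p)).card =
      if i ≤ j then strandCount n r i j else if i = j + 1 then r j i else 0) ∧
  (∀ j : ℕ, j ≤ n → ∀ p p' : Fin (totalDim n e),
    InBlockRow e j p → InBlockRow e j p' → p < p' → v p < v p') ∧
  (∀ i : ℕ, i ≤ n → ∀ p p' : Fin (totalDim n e),
    InBlockCol n e i (v p) → InBlockCol n e i (v p') → p < p' → v p < v p')

/-- The permutation that exchanges the block of the `a` numbers starting at `m` with the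
block of the next `b` numbers, each block being kept in order.  It corresponds to an
`a × b` (or `b × a`) rectangle of crossings. -/
def blockSwap (m a b : ℕ) : Perm ℕ where
  toFun x := if x < m then x else if x < m + a then x + b else if x < m + a + b then x - a else x
  invFun x := if x < m then x else if x < m + b then x + a else if x < m + b + a then x - b else x
  left_inv x := by
    dsimp only
    split_ifs <;> omega
  right_inv x := by
    dsimp only
    split_ifs <;> omega

/-- The factors, in order:  for each `j = 0, …, n - 1` the permutation `w j`, followed for
`i = j + 2, …, n` by the rectangle of crossings of all `e i` dots of column `i` with all
`e j` dots of column `j`, placed after `e (j + 1) + ⋯ + e (i - 1)` fixed points. -/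
def factorList (n : ℕ) (e : ℕ → ℕ) (w : Fin n → Perm ℕ) : List (Perm ℕ) :=
  (List.finRange n).flatMap fun j =>
    w j :: (List.range' (j + 2) (n - 1 - j)).map fun i =>
      blockSwap (∑ k ∈ Finset.Ioo (j : ℕ) i, e k) (e i) (e j)

/-- The sequence `w`, with `w j` in the symmetric group on `e j + e (j + 1)` letters, is a
KMS-factorization for the orbit `r`: the Hecke product of `w 0, …, w (n - 1)` and the rectangles
is the Zelevinsky permutation `v`, up to conjugation by the longest element (that is, with
rows and columns counted from the bottom right corner, which is what makes the dots of every column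
numbered from top to bottom). -/
def IsKMSFactorization (n : ℕ) (e : ℕ → ℕ) (r : ℕ → ℕ → ℕ) (w : Fin n → Perm ℕ) : Prop :=
  (∀ j : Fin n, ∀ k : ℕ, e j + e (j + 1) ≤ k → w j k = k) ∧
    ∃ (v : Perm (Fin (totalDim n e))) (z : Perm ℕ),
      IsZelevinsky n e r v ∧ IsHeckeProduct (factorList n e w) z ∧
        ∀ p : Fin (totalDim n e), z (Fin.rev p : Fin (totalDim n e)) = (Fin.rev (v p) : ℕ)

end KMS

namespace KMS

open Equiv

/-! ### The 0-Hecke monoid -/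

/-! All factors are read in the 0-Hecke monoid. The rectangles that follow a factor merge into a
single one (`prod_blockSwap`), so a sequence in range has a product `factorProd`, and it is a
KMS-factorization exactly when this product is the Zelevinsky permutation with rows and columns
reversed. The theorem thus says that one fibre of the product map is connected under the moves and
contains the left-most diagram.

Moves preserve the product. Let `a`, `b` be the uncrossed factors on the two sides of a column and
`g` a generator crossing two neighbouring dots of it. Then `g` commutes with the rectangle between
the factors, so the crossing may slide from `a * g` to `g * b`, and `g * g = g` accounts for the
third diagram of the triple (`factorProd_inTriple`).

Conversely, the Zelevinsky permutation and its inverse are monotone on blocks, and a descent of a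
factor beyond its dots would produce a descent of the product inside a block. Hence every sequence
in range with this product is a lace diagram (`isLaceDiagram_of_blockMono`). A descent of a factor
between two dots can be pushed across the column by a move, and the last factor has none, so moves
lead to a normal sequence, one without such descents (`exists_isNormal`). For normal sequences the
Hecke product is the ordinary product, from which the factors can be recovered one by one
(`IsNormal.eq_of_factorProd_eq`). So the fibre contains at most one normal sequence.

The left-most diagram is normal. That it lies in the fibre (`exists_isZelevinsky_leftmost`) is seen
by following wires: each carries the column where it ends as a label, labels decrease weakly along
each block of values, and their multiplicities are the strand counts and the ranks of the single
maps. This determines the Zelevinsky permutation. The strand counts behave as expected because, by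
linear algebra, they are non-negative and sum to the ranks. -/

theorem simpleSwap_lt_iff {j a b : ℕ} (h : ¬(a = j ∧ b = j + 1)) (h' : ¬(a = j + 1 ∧ b = j)) :
    simpleSwap j a < simpleSwap j b ↔ a < b := by
  unfold simpleSwap
  simp only [swap_apply_def]
  split_ifs <;> omega

@[simp] theorem simpleSwap_left (j : ℕ) : simpleSwap j j = j + 1 := swap_apply_left _ _

@[simp] theorem simpleSwap_right (j : ℕ) : simpleSwap j (j + 1) = j := swap_apply_right _ _

@[simp] theorem simpleSwap_inv (j : ℕ) : (simpleSwap j)⁻¹ = simpleSwap j := swap_inv _ _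

@[simp] theorem simpleSwap_mul_self (j : ℕ) : simpleSwap j * simpleSwap j = 1 := swap_mul_self _ _

theorem simpleSwap_of_ne {j x : ℕ} (h : x ≠ j) (h' : x ≠ j + 1) : simpleSwap j x = x :=
  swap_apply_of_ne_of_ne h h'

/-- Left multiplication by a simple transposition in the 0-Hecke monoid. -/
def heckeLeft (k : ℕ) (u : Perm ℕ) : Perm ℕ :=
  if u⁻¹ k < u⁻¹ (k + 1) then simpleSwap k * u else u

/-- The right step tests the values at positions `k`, `k + 1`, the left step the positions of the
values `j`, `j + 1`. Neither disturbs the other's test unless the two pairs coincide, and then `u *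
s_k = s_j * u`, so whichever step comes second is idle. This commutation makes having equal Hecke
products a congruence, without any use of braid relations. -/
theorem heckeLeft_heckeStep (u : Perm ℕ) (j k : ℕ) :
    heckeLeft j (heckeStep u k) = heckeStep (heckeLeft j u) k := by
  by_cases h1 : u k = j ∧ u (k + 1) = j + 1
  · have hs : u * simpleSwap k = simpleSwap j * u := by
      unfold simpleSwap
      rw [mul_swap_eq_swap_mul, h1.1, h1.2]
    have i1 : u⁻¹ j = k := by rw [Perm.inv_eq_iff_eq, h1.1]
    have i2 : u⁻¹ (j + 1) = k + 1 := by rw [Perm.inv_eq_iff_eq, h1.2]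
    have e1 : heckeStep u k = u * simpleSwap k := if_pos (by omega)
    have e2 : heckeLeft j u = u * simpleSwap k := by
      rw [hs]; exact if_pos (by omega)
    rw [e1, e2, heckeLeft, heckeStep, if_neg, if_neg]
    · simp [h1]
    · simp only [mul_inv_rev, simpleSwap_inv, Perm.mul_apply, i1, i2]
      simp
  by_cases h2 : u k = j + 1 ∧ u (k + 1) = j
  · have i1 : u⁻¹ j = k + 1 := by rw [Perm.inv_eq_iff_eq, h2.2]
    have i2 : u⁻¹ (j + 1) = k := by rw [Perm.inv_eq_iff_eq, h2.1]
    have e1 : heckeStep u k = u := if_neg (by omega)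
    have e2 : heckeLeft j u = u := if_neg (by omega)
    rw [e1, e2, e1]
  have e1 : (u * simpleSwap k)⁻¹ j < (u * simpleSwap k)⁻¹ (j + 1) ↔ u⁻¹ j < u⁻¹ (j + 1) := by
    simp only [mul_inv_rev, simpleSwap_inv, Perm.mul_apply]
    apply simpleSwap_lt_iff
    · rintro ⟨a, b⟩
      rw [Perm.inv_eq_iff_eq] at a b
      exact h1 ⟨a.symm, b.symm⟩
    · rintro ⟨a, b⟩
      rw [Perm.inv_eq_iff_eq] at a b
      exact h2 ⟨b.symm, a.symm⟩
  have e2 : (simpleSwap j * u) k < (simpleSwap j * u) (k + 1) ↔ u k < u (k + 1) := by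
    simp only [Perm.mul_apply]
    exact simpleSwap_lt_iff h1 h2
  unfold heckeLeft heckeStep
  by_cases a : u k < u (k + 1) <;> by_cases b : u⁻¹ j < u⁻¹ (j + 1)
  · rw [if_pos a, if_pos (e1.2 b), if_pos b, if_pos (e2.2 a), mul_assoc]
  · rw [if_pos a, if_neg (mt e1.1 b), if_neg b, if_pos a]
  · rw [if_neg a, if_pos b, if_neg (mt e2.1 a)]
  · rw [if_neg a, if_neg b, if_neg a]

theorem heckeStep_inv (u : Perm ℕ) (k : ℕ) : (heckeStep u k)⁻¹ = heckeLeft k u⁻¹ := by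
  unfold heckeStep heckeLeft
  rw [inv_inv]
  split_ifs
  · rw [mul_inv_rev, simpleSwap_inv]
  · rfl

/-- The Hecke product of the simple transpositions in a word. -/
def heckeWord (a : List ℕ) : Perm ℕ := a.foldl heckeStep 1

theorem heckeWord_concat (a : List ℕ) (k : ℕ) :
    heckeWord (a ++ [k]) = heckeStep (heckeWord a) k := by
  simp [heckeWord]

theorem heckeLeft_foldl (j : ℕ) (a : List ℕ) (u : Perm ℕ) :
    heckeLeft j (a.foldl heckeStep u) = a.foldl heckeStep (heckeLeft j u) := by
  induction a generalizing u with
  | nil => rfl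
  | cons k a ih => simp only [List.foldl_cons, ih, heckeLeft_heckeStep]

theorem heckeWord_cons (j : ℕ) (a : List ℕ) :
    heckeWord (j :: a) = heckeLeft j (heckeWord a) := by
  rw [heckeWord, heckeWord, heckeLeft_foldl, List.foldl_cons]
  simp [heckeStep, heckeLeft]

theorem heckeWord_append (a b : List ℕ) :
    heckeWord (a ++ b) = a.foldr heckeLeft (heckeWord b) := by
  induction a with
  | nil => rfl
  | cons k a ih => rw [List.cons_append, heckeWord_cons, ih, List.foldr_cons]

/-- Two words are congruent when they have the same Hecke product. -/
def heckeCon : Con (FreeMonoid ℕ) where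
  r a b := heckeWord a.toList = heckeWord b.toList
  iseqv := ⟨fun _ => rfl, fun h => h.symm, fun h h' => h.trans h'⟩
  mul' := by
    intro a b c d h h'
    change heckeWord (a.toList ++ c.toList) = heckeWord (b.toList ++ d.toList)
    -- The right factor is replaced by letting the left word act on it, the left factor by letting
    -- the right word act.
    rw [heckeWord_append, h', ← heckeWord_append]
    simp only [heckeWord, List.foldl_append] at h ⊢
    rw [h]

/-- The 0-Hecke monoid of the finitely supported permutations. -/
abbrev Hecke : Type := heckeCon.Quotient

namespace Hecke

/-- The element of the 0-Hecke monoid represented by a word. -/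
def ofWord (a : List ℕ) : Hecke := ((FreeMonoid.ofList a : FreeMonoid ℕ) : heckeCon.Quotient)

/-- The permutation corresponding to an element of the 0-Hecke monoid. -/
def perm (x : Hecke) : Perm ℕ :=
  Con.liftOn x (fun a => heckeWord a.toList) fun _ _ h => h

/-- The generators of the 0-Hecke monoid. -/
def gen (k : ℕ) : Hecke := ofWord [k]

@[simp] theorem perm_ofWord (a : List ℕ) : perm (ofWord a) = heckeWord a := rfl

theorem ofWord_append (a b : List ℕ) : ofWord (a ++ b) = ofWord a * ofWord b := rfl

theorem ofWord_nil : ofWord [] = 1 := rfl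

@[simp] theorem perm_one : perm 1 = 1 := rfl

theorem exists_ofWord (x : Hecke) : ∃ a, ofWord a = x := by
  induction x using Con.induction_on with
  | H a => exact ⟨a.toList, rfl⟩

theorem perm_injective : Function.Injective perm := by
  intro x y h
  obtain ⟨a, rfl⟩ := exists_ofWord x
  obtain ⟨b, rfl⟩ := exists_ofWord y
  exact (Con.eq heckeCon).2 h

theorem perm_mul_gen (x : Hecke) (k : ℕ) : perm (x * gen k) = heckeStep (perm x) k := by
  obtain ⟨a, rfl⟩ := exists_ofWord x
  rw [gen, ← ofWord_append, perm_ofWord, heckeWord_concat, perm_ofWord]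

theorem perm_gen_mul (x : Hecke) (k : ℕ) : perm (gen k * x) = heckeLeft k (perm x) := by
  obtain ⟨a, rfl⟩ := exists_ofWord x
  rw [gen, ← ofWord_append, perm_ofWord, List.singleton_append, heckeWord_cons, perm_ofWord]

theorem perm_mul_gen_of_lt {x : Hecke} {k : ℕ} (h : perm x k < perm x (k + 1)) :
    perm (x * gen k) = perm x * simpleSwap k := by
  rw [perm_mul_gen]; exact if_pos h

theorem perm_gen_mul_of_lt {x : Hecke} {k : ℕ} (h : (perm x)⁻¹ k < (perm x)⁻¹ (k + 1)) :
    perm (gen k * x) = simpleSwap k * perm x := by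
  rw [perm_gen_mul]; exact if_pos h

theorem mul_gen_eq_self_iff {x : Hecke} {k : ℕ} :
    x * gen k = x ↔ perm x (k + 1) < perm x k := by
  rw [← perm_injective.eq_iff, perm_mul_gen, heckeStep]
  have hne : perm x k ≠ perm x (k + 1) := by simp
  split_ifs with h
  · constructor
    · intro h'
      have := congrArg (fun f : Perm ℕ => f k) h'
      simp at this
    · intro; omega
  · simp only [true_iff]; omega

theorem gen_mul_eq_self_iff {x : Hecke} {k : ℕ} :
    gen k * x = x ↔ (perm x)⁻¹ (k + 1) < (perm x)⁻¹ k := by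
  rw [← perm_injective.eq_iff, perm_gen_mul, heckeLeft]
  have hne : (perm x)⁻¹ k ≠ (perm x)⁻¹ (k + 1) := by simp
  split_ifs with h
  · constructor
    · intro h'
      rw [mul_eq_right] at h'
      have := congrArg (fun f : Perm ℕ => f k) h'
      simp at this
    · intro; omega
  · simp only [true_iff]; omega

theorem gen_mul_gen_self (k : ℕ) : gen k * gen k = gen k := by
  rw [mul_gen_eq_self_iff]
  have : perm (gen k) = simpleSwap k := by
    rw [← one_mul (gen k), perm_mul_gen_of_lt] <;> simp
  simp [this]

/-- This is how a generator passes through a factor that carries two neighbouring wires to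
neighbouring places in the same order: both products get longer, and conjugation turns one
transposition into the other. -/
theorem gen_mul_eq_mul_gen {x : Hecke} {j k : ℕ} (h : perm x k = j) (h' : perm x (k + 1) = j + 1) :
    gen j * x = x * gen k := by
  have i1 : (perm x)⁻¹ j = k := by rw [Perm.inv_eq_iff_eq, h]
  have i2 : (perm x)⁻¹ (j + 1) = k + 1 := by rw [Perm.inv_eq_iff_eq, h']
  apply perm_injective
  rw [perm_mul_gen_of_lt (by omega), perm_gen_mul_of_lt (by omega)]
  unfold simpleSwap
  rw [mul_swap_eq_swap_mul, h, h']

end Hecke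

/-! ### Words for permutations -/

/-- `u` fixes all numbers outside the interval `[l, h)`. -/
def FixesOutside (l h : ℕ) (u : Perm ℕ) : Prop := ∀ k, k < l ∨ h ≤ k → u k = k

namespace FixesOutside

theorem inv {l h : ℕ} {u : Perm ℕ} (hu : FixesOutside l h u) : FixesOutside l h u⁻¹ := by
  intro k hk
  rw [Perm.inv_eq_iff_eq, hu k hk]

theorem mul {l h : ℕ} {u v : Perm ℕ} (hu : FixesOutside l h u) (hv : FixesOutside l h v) :
    FixesOutside l h (u * v) := by
  intro k hk
  rw [Perm.mul_apply, hv k hk, hu k hk]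

theorem mono {l h l' h' : ℕ} {u : Perm ℕ} (hu : FixesOutside l h u) (hl : l' ≤ l) (hh : h ≤ h') :
    FixesOutside l' h' u := fun k hk => hu k (by omega)

theorem apply_mem {l h : ℕ} {u : Perm ℕ} (hu : FixesOutside l h u) {k : ℕ} (hk : l ≤ k ∧ k < h) :
    l ≤ u k ∧ u k < h := by
  by_contra hc
  have := hu (u k) (by omega)
  have := u.injective this
  omega

theorem simpleSwap {l h k : ℕ} (hl : l ≤ k) (hh : k + 1 < h) :
    FixesOutside l h (simpleSwap k) := by
  intro x hx
  exact simpleSwap_of_ne (by omega) (by omega)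

theorem one (l h : ℕ) : FixesOutside l h 1 := fun _ _ => rfl

end FixesOutside

theorem eq_one_of_strictMono {u : Perm ℕ} (h : ∀ k, u k < u (k + 1)) : u = 1 := by
  have hm : StrictMono u := strictMono_nat_of_lt_succ h
  have : (hm.orderIsoOfSurjective u u.surjective) = OrderIso.refl ℕ := Subsingleton.elim _ _
  ext k
  exact congrArg (fun f : ℕ ≃o ℕ => f k) this

/-- A weighted sum that drops when a descent is removed. -/
theorem sum_mul_simpleSwap_lt {h k : ℕ} {u : Perm ℕ} (hk : k + 1 < h) (hd : u (k + 1) < u k) :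
    ∑ q ∈ Finset.range h, (h - q) * (u * simpleSwap k) q < ∑ q ∈ Finset.range h, (h - q) * u q := by
  have h1 : k ∈ Finset.range h := by simp; omega
  have h2 : k + 1 ∈ (Finset.range h).erase k := by simp; omega
  rw [← Finset.add_sum_erase _ _ h1, ← Finset.add_sum_erase _ _ h1, ← Finset.add_sum_erase _ _ h2,
    ← Finset.add_sum_erase _ _ h2]
  have h3 : ∑ q ∈ ((Finset.range h).erase k).erase (k + 1), (h - q) * (u * simpleSwap k) q =
      ∑ q ∈ ((Finset.range h).erase k).erase (k + 1), (h - q) * u q := by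
    apply Finset.sum_congr rfl
    intro q hq
    simp only [Finset.mem_erase] at hq
    rw [Perm.mul_apply, simpleSwap_of_ne hq.2.1 hq.1]
  rw [h3]
  simp only [Perm.mul_apply, simpleSwap_left, simpleSwap_right]
  obtain ⟨m, hm⟩ : ∃ m, h - (k + 1) = m := ⟨_, rfl⟩
  have hm' : h - k = m + 1 := by omega
  rw [hm, hm']
  nlinarith

/-- The interval is preserved, so ascents outside it and across its ends are automatic; ascents
inside as well would force the identity. -/
theorem exists_descent {l h : ℕ} {u : Perm ℕ} (hu : FixesOutside l h u) (hne : u ≠ 1) :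
    ∃ k, l ≤ k ∧ k + 1 < h ∧ u (k + 1) < u k := by
  by_contra! hc
  apply hne
  apply eq_one_of_strictMono
  intro k
  have hne : u k ≠ u (k + 1) := by simp
  by_cases h1 : k < l
  · rw [hu k (Or.inl h1)]
    by_cases h2 : k + 1 < l ∨ h ≤ k + 1
    · rw [hu _ h2]; omega
    · have := hu.apply_mem (k := k + 1) (by omega)
      omega
  by_cases h3 : h ≤ k + 1
  · rw [hu _ (Or.inr h3)]
    by_cases h2 : k < l ∨ h ≤ k
    · rw [hu _ h2]; omega
    · have := hu.apply_mem (k := k) (by omega)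
      omega
  have := hc k (by omega) (by omega)
  omega

/-- Sorting by adjacent transpositions at descents: the weighted sum of the values drops each time.
That the letters stay in the interval is what later confines products to it. -/
theorem exists_heckeWord {l h : ℕ} {u : Perm ℕ} (hu : FixesOutside l h u) :
    ∃ a : List ℕ, (∀ k ∈ a, l ≤ k ∧ k + 1 < h) ∧ heckeWord a = u := by
  induction hs : ∑ q ∈ Finset.range h, (h - q) * u q using Nat.strong_induction_on
    generalizing u with
  | _ s ih =>
    by_cases hne : u = 1
    · exact ⟨[], by simp, hne ▸ rfl⟩
    obtain ⟨k, hl, hh, hd⟩ := exists_descent hu hne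
    obtain ⟨a, ha, ha'⟩ := ih _ (hs ▸ sum_mul_simpleSwap_lt hh hd)
      (hu.mul (FixesOutside.simpleSwap hl hh)) rfl
    refine ⟨a ++ [k], ?_, ?_⟩
    · simp only [List.mem_append, List.mem_singleton]
      rintro x (hx | rfl)
      · exact ha x hx
      · exact ⟨hl, hh⟩
    · rw [heckeWord_concat, ha', heckeStep, if_pos (by simpa using hd), mul_assoc,
        simpleSwap_mul_self, mul_one]

theorem fixesOutside_heckeWord {l h : ℕ} {a : List ℕ} (ha : ∀ k ∈ a, l ≤ k ∧ k + 1 < h) :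
    FixesOutside l h (heckeWord a) := by
  induction a using List.reverseRecOn with
  | nil => exact FixesOutside.one l h
  | append_singleton a k ih =>
    rw [heckeWord_concat, heckeStep]
    have h1 := ih fun x hx => ha x (by simp [hx])
    have h2 := ha k (by simp)
    split_ifs
    · exact h1.mul (FixesOutside.simpleSwap h2.1 h2.2)
    · exact h1

/-- `u` is finitely supported. -/
def FinSupp (u : Perm ℕ) : Prop := ∃ N, FixesOutside 0 N u

theorem finSupp_heckeWord (a : List ℕ) : FinSupp (heckeWord a) := by
  refine ⟨a.sum + 2, fixesOutside_heckeWord fun k hk => ⟨by omega, ?_⟩⟩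
  have := List.single_le_sum (fun x _ => Nat.zero_le x) k hk
  omega

namespace Hecke

open Classical in
/-- The element of the 0-Hecke monoid that corresponds to a finitely supported permutation. -/
noncomputable def of (u : Perm ℕ) : Hecke := if h : ∃ x, perm x = u then h.choose else 1

theorem finSupp_perm (x : Hecke) : FinSupp (perm x) := by
  obtain ⟨a, rfl⟩ := exists_ofWord x
  exact finSupp_heckeWord a

theorem perm_of {u : Perm ℕ} (hu : FinSupp u) : perm (of u) = u := by
  obtain ⟨N, hN⟩ := hu
  obtain ⟨a, -, ha⟩ := exists_heckeWord hN
  have h : ∃ x, perm x = u := ⟨ofWord a, ha⟩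
  rw [of, dif_pos h, h.choose_spec]

theorem of_perm (x : Hecke) : of (perm x) = x := perm_injective (perm_of (finSupp_perm x))

theorem of_eq {u : Perm ℕ} {x : Hecke} (h : perm x = u) : of u = x := h ▸ of_perm x

theorem exists_word_of_fixesOutside {l h : ℕ} {x : Hecke} (hx : FixesOutside l h (perm x)) :
    ∃ a : List ℕ, (∀ k ∈ a, l ≤ k ∧ k + 1 < h) ∧ ofWord a = x := by
  obtain ⟨a, ha, ha'⟩ := exists_heckeWord hx
  exact ⟨a, ha, perm_injective ha'⟩

theorem fixesOutside_mul {l h : ℕ} {x y : Hecke} (hx : FixesOutside l h (perm x))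
    (hy : FixesOutside l h (perm y)) : FixesOutside l h (perm (x * y)) := by
  obtain ⟨a, ha, rfl⟩ := exists_word_of_fixesOutside hx
  obtain ⟨b, hb, rfl⟩ := exists_word_of_fixesOutside hy
  rw [← ofWord_append, perm_ofWord]
  apply fixesOutside_heckeWord
  intro k hk
  rw [List.mem_append] at hk
  exact hk.elim (ha k) (hb k)

/-- The Hecke product is the product if the left factor is increasing on an interval that supports
the right factor. -/
theorem perm_mul_of_strictMonoOn {l h : ℕ} {x y : Hecke} (hy : FixesOutside l h (perm y))
    (hx : ∀ a b, l ≤ a → a < b → b < h → perm x a < perm x b) :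
    perm (x * y) = perm x * perm y := by
  obtain ⟨a, ha, rfl⟩ := exists_word_of_fixesOutside hy
  clear hy
  induction a using List.reverseRecOn with
  | nil => simp [ofWord_nil]
  | append_singleton a k ih =>
    have h1 := ih fun x hx => ha x (by simp [hx])
    have h2 := ha k (by simp)
    have h3 : FixesOutside l h (perm (ofWord a)) :=
      fixesOutside_heckeWord fun x hx => ha x (List.mem_append_left _ hx)
    have h4 := h3.apply_mem (k := k) (by omega)
    have h5 := h3.apply_mem (k := k + 1) (by omega)
    have h6 : perm (ofWord a) k ≠ perm (ofWord a) (k + 1) := by simp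
    -- The two values compared lie in the interval where `x` is increasing, so the step lengthens
    -- the product exactly when it lengthens the right factor.
    have key : perm (x * ofWord a) k < perm (x * ofWord a) (k + 1) ↔
        perm (ofWord a) k < perm (ofWord a) (k + 1) := by
      rw [h1, Perm.mul_apply, Perm.mul_apply]
      constructor
      · intro h7
        by_contra h8
        exact absurd (hx _ _ h5.1 (by omega) h4.2) (by omega)
      · intro h7
        exact hx _ _ h4.1 h7 h5.2
    rw [ofWord_append, ← mul_assoc]
    change perm (x * ofWord a * gen k) = perm x * perm (ofWord a * gen k)
    rw [perm_mul_gen, perm_mul_gen, heckeStep, heckeStep]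
    by_cases h8 : perm (ofWord a) k < perm (ofWord a) (k + 1)
    · rw [if_pos h8, if_pos (key.2 h8), h1, mul_assoc]
    · rw [if_neg h8, if_neg (mt key.1 h8), h1]

theorem perm_ofWord_reverse (a : List ℕ) : perm (ofWord a.reverse) = (perm (ofWord a))⁻¹ := by
  induction a using List.reverseRecOn with
  | nil => simp [ofWord_nil]
  | append_singleton a k ih =>
    rw [List.reverse_append, perm_ofWord, perm_ofWord, heckeWord_concat, heckeStep_inv,
      List.reverse_singleton, List.singleton_append, heckeWord_cons]
    exact congrArg _ ih

/-- The Hecke product is the product if the inverse of the right factor is increasing on an interval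
that supports the left factor. -/
theorem perm_mul_of_strictMonoOn_inv {l h : ℕ} {x y : Hecke} (hx : FixesOutside l h (perm x))
    (hy : ∀ a b, l ≤ a → a < b → b < h → (perm y)⁻¹ a < (perm y)⁻¹ b) :
    perm (x * y) = perm x * perm y := by
  obtain ⟨a, rfl⟩ := exists_ofWord x
  obtain ⟨b, rfl⟩ := exists_ofWord y
  -- Reversing words inverts permutations and interchanges the two factors.
  have h1 := perm_mul_of_strictMonoOn (x := ofWord b.reverse) (y := ofWord a.reverse) (l := l)
    (h := h) (by rw [perm_ofWord_reverse]; exact hx.inv) (by rw [perm_ofWord_reverse]; exact hy)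
  rw [← ofWord_append, ← List.reverse_append, perm_ofWord_reverse, perm_ofWord_reverse,
    perm_ofWord_reverse, ← mul_inv_rev] at h1
  rw [← ofWord_append]
  exact inv_injective h1

end Hecke

/-! ### Reduced words -/

/-- The exchange property. The transposition is pushed leftwards through the word; as the whole word
inverts the pair, some letter must exchange its two current entries, and that letter is deleted. -/
theorem exists_word_mul_swap {a : List ℕ} {m m' : ℕ} (h : m < m')
    (hd : (a.map simpleSwap).prod m' < (a.map simpleSwap).prod m) :
    ∃ b : List ℕ, b.length < a.length ∧
      (b.map simpleSwap).prod = (a.map simpleSwap).prod * swap m m' := by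
  induction a using List.reverseRecOn generalizing m m' with
  | nil => simp at hd; omega
  | append_singleton a j ih =>
    simp only [List.map_append, List.prod_append, List.map_cons, List.map_nil, List.prod_singleton,
      Perm.mul_apply] at hd ⊢
    by_cases h1 : m = j ∧ m' = j + 1
    · refine ⟨a, by simp, ?_⟩
      obtain ⟨rfl, rfl⟩ := h1
      rw [mul_assoc]
      change _ = _ * (simpleSwap m * simpleSwap m)
      simp
    · have h2 : simpleSwap j m < simpleSwap j m' := (simpleSwap_lt_iff h1 (by omega)).2 h
      obtain ⟨b, hb, hb'⟩ := ih h2 hd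
      refine ⟨b ++ [j], by simpa using hb, ?_⟩
      simp only [List.map_append, List.prod_append, List.map_cons, List.map_nil,
        List.prod_singleton, hb']
      rw [mul_assoc, mul_assoc, mul_swap_eq_swap_mul]

theorem IsReducedWord.of_concat {a : List ℕ} {k : ℕ} {u : Perm ℕ}
    (h : IsReducedWord (a ++ [k]) u) : IsReducedWord a (a.map simpleSwap).prod := by
  refine ⟨rfl, fun b hb => ?_⟩
  have := h.2 (b ++ [k]) (by rw [← h.1]; simp [hb])
  simpa using this

/-- An idle Hecke step would occur at a descent, and the exchange property would then give a shorter
word. -/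
theorem IsReducedWord.heckeWord_eq {a : List ℕ} {u : Perm ℕ} (h : IsReducedWord a u) :
    heckeWord a = u := by
  induction a using List.reverseRecOn generalizing u with
  | nil => rw [← h.1]; rfl
  | append_singleton a k ih =>
    have h1 := ih h.of_concat
    rw [heckeWord_concat, h1, heckeStep, ← h.1]
    split_ifs with h2
    · simp
    · exfalso
      have h3 : (a.map simpleSwap).prod k ≠ (a.map simpleSwap).prod (k + 1) := by simp
      obtain ⟨b, hb, hb'⟩ := exists_word_mul_swap (a := a) (Nat.lt_succ_self k)
        (by simp only [Nat.succ_eq_add_one]; omega)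
      have := h.2 b (by rw [hb', ← h.1]; simp [simpleSwap])
      simp at this
      omega

theorem exists_word_prod_eq (a : List ℕ) : ∃ b : List ℕ, (b.map simpleSwap).prod = heckeWord a := by
  induction a using List.reverseRecOn with
  | nil => exact ⟨[], rfl⟩
  | append_singleton a k ih =>
    obtain ⟨b, hb⟩ := ih
    rw [heckeWord_concat, heckeStep]
    split_ifs
    · exact ⟨b ++ [k], by simp [hb]⟩
    · exact ⟨b, hb⟩

/-- The least length of a word for `u`. -/
noncomputable def wordLength (u : Perm ℕ) : ℕ :=
  sInf {l | ∃ b : List ℕ, (b.map simpleSwap).prod = u ∧ b.length = l}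

theorem wordLength_le (b : List ℕ) : wordLength (b.map simpleSwap).prod ≤ b.length :=
  Nat.sInf_le ⟨b, rfl, rfl⟩

theorem FinSupp.exists_reduced {u : Perm ℕ} (hu : FinSupp u) :
    ∃ b : List ℕ, IsReducedWord b u ∧ b.length = wordLength u := by
  obtain ⟨N, hN⟩ := hu
  obtain ⟨a, -, rfl⟩ := exists_heckeWord hN
  obtain ⟨b, hb⟩ := exists_word_prod_eq a
  obtain ⟨c, hc, hc'⟩ := Nat.sInf_mem
    (s := {l | ∃ b : List ℕ, (b.map simpleSwap).prod = heckeWord a ∧ b.length = l}) ⟨_, b, hb, rfl⟩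
  exact ⟨c, ⟨hc, fun d hd => hc' ▸ Nat.sInf_le ⟨d, hd, rfl⟩⟩, hc'⟩

theorem wordLength_simpleSwap_mul_le {u : Perm ℕ} (hu : FinSupp u) (k : ℕ) :
    wordLength (simpleSwap k * u) ≤ wordLength u + 1 := by
  obtain ⟨b, hb, hb'⟩ := hu.exists_reduced
  have := wordLength_le (k :: b)
  simpa [hb.1, hb'] using this

theorem wordLength_mul_simpleSwap_lt {u : Perm ℕ} (hu : FinSupp u) {k : ℕ} (h : u (k + 1) < u k) :
    wordLength (u * simpleSwap k) < wordLength u := by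
  obtain ⟨b, hb, hb'⟩ := hu.exists_reduced
  obtain ⟨c, hc, hc'⟩ := exists_word_mul_swap (a := b) (Nat.lt_succ_self k) (by rw [hb.1]; exact h)
  rw [hb.1] at hc'
  have := wordLength_le c
  rw [hc'] at this
  exact lt_of_le_of_lt this (hb' ▸ hc)

/-- The passage to the monoid: the result does not depend on the chosen reduced words, and finite
support guarantees that there are some. -/
theorem isHeckeProduct_iff {us : List (Perm ℕ)} (h : ∀ u ∈ us, FinSupp u) (z : Perm ℕ) :
    IsHeckeProduct us z ↔ Hecke.perm (us.map Hecke.of).prod = z := by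
  have key : ∀ words : List (List ℕ), List.Forall₂ IsReducedWord words us →
      Hecke.ofWord words.flatten = (us.map Hecke.of).prod := by
    intro words hw
    clear h
    induction hw with
    | nil => rfl
    | cons h _ ih =>
      rw [List.flatten_cons, Hecke.ofWord_append, ih, List.map_cons, List.prod_cons,
        Hecke.of_eq (x := Hecke.ofWord _) h.heckeWord_eq]
  constructor
  · rintro ⟨words, hw, rfl⟩
    rw [← key words hw]
    rfl
  · rintro rfl
    have : ∃ words, List.Forall₂ IsReducedWord words us := by
      clear key
      induction us with
      | nil => exact ⟨[], .nil⟩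
      | cons u us ih =>
        obtain ⟨ws, hws⟩ := ih fun v hv => h v (by simp [hv])
        obtain ⟨b, hb, -⟩ := (h u (by simp)).exists_reduced
        exact ⟨b :: ws, .cons hb hws⟩
    obtain ⟨words, hw⟩ := this
    refine ⟨words, hw, ?_⟩
    rw [← key words hw]
    rfl


/-! ### Partial permutations -/

theorem apply_inv_self' (u : Perm ℕ) (x : ℕ) : u (u⁻¹ x) = x := u.apply_symm_apply x

theorem inv_apply_self' (u : Perm ℕ) (x : ℕ) : u⁻¹ (u x) = x := u.symm_apply_apply x

theorem IsPartialPerm.inv {a b : ℕ} {u : Perm ℕ} (hu : IsPartialPerm a b u) :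
    IsPartialPerm b a u⁻¹ := by
  obtain ⟨N, hN⟩ := hu.1
  exact ⟨⟨N, fun k hk => by rw [Perm.inv_eq_iff_eq, hN k hk]⟩, hu.2.2, by simpa using hu.2.1⟩

theorem lt_of_forall_lt_succ {a : ℕ} {f : ℕ → ℕ} (h : ∀ k, a ≤ k → f k < f (k + 1)) {k k' : ℕ}
    (hk : a ≤ k) (hkk : k < k') : f k < f k' := by
  induction k', hkk using Nat.le_induction with
  | base => exact h k hk
  | succ m hm ih => exact ih.trans (h m (by omega))

theorem lt_of_forall_lt_succ_Ico {a b : ℕ} {f : ℕ → ℕ}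
    (h : ∀ k, a ≤ k → k + 1 < b → f k < f (k + 1)) {k k' : ℕ}
    (hk : a ≤ k) (hkk : k < k') (hb : k' < b) : f k < f k' := by
  induction k', hkk using Nat.le_induction with
  | base => exact h k hk hb
  | succ m hm ih => exact (ih (by omega)).trans (h m (by omega) hb)

theorem IsPartialPerm.lt {a b : ℕ} {u : Perm ℕ} (hu : IsPartialPerm a b u) {k k' : ℕ}
    (hk : a ≤ k) (hkk : k < k') : u k < u k' := lt_of_forall_lt_succ hu.2.1 hk hkk

theorem IsPartialPerm.lt_iff {a b : ℕ} {u : Perm ℕ} (hu : IsPartialPerm a b u) {k k' : ℕ}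
    (hk : a ≤ k) (hk' : a ≤ k') : u k < u k' ↔ k < k' := by
  constructor
  · intro h
    by_contra hc
    rcases (not_lt.1 hc).eq_or_lt with rfl | hc
    · omega
    · exact absurd (hu.lt hk' hc) (by omega)
  · exact hu.lt hk

/-- The position of a large value of a partial permutation is determined by the positions of the
large values. -/
theorem IsPartialPerm.apply_eq {a b : ℕ} {u : Perm ℕ} (hu : IsPartialPerm a b u) {q : ℕ}
    (hq : b ≤ u q) : u q = b + ((Finset.range q).filter fun q' => b ≤ u q').card := by
  -- As `u⁻¹` increases on the numbers from `b` on, the values in `[b, u q)` occupy exactly the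
  -- earlier positions of large values.
  have h : (Finset.Ico b (u q)).card = ((Finset.range q).filter fun q' => b ≤ u q').card := by
    apply Finset.card_bij (fun x _ => u⁻¹ x)
    · intro x hx
      simp only [Finset.mem_Ico] at hx
      simp only [Finset.mem_filter, Finset.mem_range, apply_inv_self']
      refine ⟨?_, hx.1⟩
      have := (hu.inv.lt hx.1 hx.2)
      rwa [inv_apply_self'] at this
    · intro x _ y _ h
      exact u⁻¹.injective h
    · intro y hy
      simp only [Finset.mem_filter, Finset.mem_range] at hy
      refine ⟨u y, ?_, by rw [inv_apply_self']⟩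
      simp only [Finset.mem_Ico]
      refine ⟨hy.2, ?_⟩
      rw [← hu.inv.lt_iff hy.2 hq, inv_apply_self', inv_apply_self']
      exact hy.1
  rw [Nat.card_Ico] at h
  omega

/-- A partial permutation is determined by the connections of the dots. -/
theorem IsPartialPerm.ext {a b : ℕ} {u v : Perm ℕ} (hu : IsPartialPerm a b u)
    (hv : IsPartialPerm a b v) (h : ∀ q p, q < a → p < b → (u q = p ↔ v q = p)) : u = v := by
  have ha : ∀ q, q < a → (b ≤ u q ↔ b ≤ v q) := by
    intro q hq
    constructor
    · intro h1
      by_contra h2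
      have := (h q (v q) hq (by omega)).2 rfl
      omega
    · intro h1
      by_contra h2
      have := (h q (u q) hq (by omega)).1 rfl
      omega
  have hb : ∀ p, p < b → (a ≤ u⁻¹ p ↔ a ≤ v⁻¹ p) := by
    intro p hp
    constructor
    · intro h1
      by_contra h2
      have := (h (v⁻¹ p) p (by omega) hp).2 (apply_inv_self' _ _)
      rw [← this, inv_apply_self'] at h1
      omega
    · intro h1
      by_contra h2
      have := (h (u⁻¹ p) p (by omega) hp).1 (apply_inv_self' _ _)
      rw [← this, inv_apply_self'] at h1
      omega
  -- An unconnected dot has its preimage beyond the dots of the other column, and such preimages are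
  -- filled in increasing order.
  have hb' : ∀ p, p < b → u⁻¹ p = v⁻¹ p := by
    intro p hp
    by_cases h1 : a ≤ u⁻¹ p
    · rw [hu.inv.apply_eq h1, hv.inv.apply_eq ((hb p hp).1 h1)]
      congr 2
      apply Finset.filter_congr
      intro x hx
      exact hb x (by simp at hx; omega)
    · have := (h (u⁻¹ p) p (by omega) hp).1 (apply_inv_self' _ _)
      rw [← this, inv_apply_self', this]
  have hall : ∀ q, b ≤ u q ↔ b ≤ v q := by
    intro q
    constructor
    · intro h1
      by_contra h2
      have := hb' (v q) (by omega)
      rw [inv_apply_self', Perm.inv_eq_iff_eq] at this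
      omega
    · intro h1
      by_contra h2
      have := hb' (u q) (by omega)
      rw [inv_apply_self', eq_comm, Perm.inv_eq_iff_eq] at this
      omega
  apply Equiv.ext
  intro q
  by_cases h1 : b ≤ u q
  · rw [hu.apply_eq h1, hv.apply_eq ((hall q).1 h1)]
    congr 2
    apply Finset.filter_congr
    intro x _
    exact hall x
  · have := hb' (u q) (by omega)
    rw [inv_apply_self', eq_comm, Perm.inv_eq_iff_eq] at this
    exact this

/-- Puts the factors of a lace diagram in range. If `k ≥ a + b` were the largest number moved,
monotonicity of `u⁻¹` from `b` on would give `u k < b`, and monotonicity of `u` from `a` on would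
inject the more than `b` elements of `[a, k]` into the numbers below `b`. -/
theorem IsPartialPerm.fixesOutside {a b : ℕ} {u : Perm ℕ} (hu : IsPartialPerm a b u) :
    FixesOutside 0 (a + b) u := by
  obtain ⟨N, hN⟩ := hu.1
  have key : ∀ d k, a + b ≤ k → N ≤ k + d → u k = k := by
    intro d
    induction d with
    | zero => exact fun k _ h => hN k h
    | succ d ih =>
      intro k hk hd
      have hgt : ∀ x, k < x → u x = x := fun x hx => ih x (by omega) (by omega)
      have hle : u k ≤ k := by
        by_contra hc
        have := u.injective (hgt (u k) (by omega))
        omega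
      by_contra hne
      have hlt : u⁻¹ k < k := by
        by_contra hc
        rcases (not_lt.1 hc).eq_or_lt with h1 | h1
        · rw [eq_comm, Perm.inv_eq_iff_eq] at h1
          omega
        · have := hgt _ h1
          rw [apply_inv_self'] at this
          omega
      have hy : u k < b := by
        by_contra hc
        have := hu.inv.lt (not_lt.1 hc) (lt_of_le_of_ne hle hne)
        rw [inv_apply_self'] at this
        omega
      have hcard : (Finset.Icc a k).card ≤ (Finset.range b).card := by
        apply Finset.card_le_card_of_injOn u
        · intro q hq
          simp only [Finset.coe_Icc, Set.mem_Icc] at hq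
          simp only [Finset.coe_range, Set.mem_Iio]
          rcases hq.2.eq_or_lt with rfl | h1
          · exact hy
          · exact (hu.lt hq.1 h1).trans hy
        · exact u.injective.injOn
      simp only [Nat.card_Icc, Finset.card_range] at hcard
      omega
  intro k hk
  exact key N k (by omega) (by omega)

/-! ### Grassmannian partial permutations -/

theorem nth_spec {D : ℕ → Prop} [DecidablePred D] {b q : ℕ} (h : q < Nat.count D b) :
    D (Nat.nth D q) ∧ Nat.count D (Nat.nth D q) = q ∧ Nat.nth D q < b := by
  have hf : ∀ hf : (Set.ofPred D).Finite, q < hf.toFinset.card :=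
    fun hf => h.trans_le (Nat.count_le_card hf b)
  exact ⟨Nat.nth_mem q hf, Nat.count_nth hf, Nat.nth_lt_of_lt_count h⟩

theorem nth_lt_nth_of_lt_count {D : ℕ → Prop} [DecidablePred D] {b q q' : ℕ}
    (h : q' < Nat.count D b) (hq : q < q') : Nat.nth D q < Nat.nth D q' :=
  Nat.nth_lt_nth' hq fun hf => h.trans_le (Nat.count_le_card hf b)

theorem count_add_count_not (D : ℕ → Prop) [DecidablePred D] (b : ℕ) :
    Nat.count D b + Nat.count (fun x => ¬D x) b = b := by
  induction b with
  | zero => simp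
  | succ b ih =>
    rw [Nat.count_succ, Nat.count_succ]
    split_ifs <;> omega

/-- The partial permutation from `a` to `b` elements that connects, in order, the first elements
on one side to the elements satisfying `D` on the other side. -/
noncomputable def grass (a b : ℕ) (D : ℕ → Prop) [DecidablePred D]
    (hc : Nat.count D b ≤ a) : Perm ℕ where
  toFun q :=
    -- In turn: the connected dots, the remaining dots sent to virtual places, the virtual places
    -- that receive the dots outside `D`, and fixed points.
    if q < Nat.count D b then Nat.nth D q
    else if q < a then b + (q - Nat.count D b)
    else if q < a + (b - Nat.count D b) then Nat.nth (fun x => ¬D x) (q - a)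
    else q
  invFun p :=
    if p < b then (if D p then Nat.count D p else a + Nat.count (fun x => ¬D x) p)
    else if p < b + (a - Nat.count D b) then p - b + Nat.count D b
    else p
  left_inv q := by
    have h1 := count_add_count_not D b
    dsimp only
    by_cases a1 : q < Nat.count D b
    · obtain ⟨b1, b2, b3⟩ := nth_spec a1
      rw [if_pos a1, if_pos b3, if_pos b1, b2]
    rw [if_neg a1]
    by_cases a2 : q < a
    · rw [if_pos a2, if_neg (by omega), if_pos (by omega)]
      omega
    rw [if_neg a2]
    by_cases a3 : q < a + (b - Nat.count D b)
    · obtain ⟨b1, b2, b3⟩ := nth_spec (D := fun x => ¬D x) (b := b) (q := q - a) (by omega)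
      rw [if_pos a3, if_pos b3, if_neg b1, b2]
      omega
    · rw [if_neg a3, if_neg (by omega), if_neg (by omega)]
  right_inv p := by
    have h1 := count_add_count_not D b
    dsimp only
    by_cases a1 : p < b
    · rw [if_pos a1]
      by_cases a2 : D p
      · rw [if_pos a2, if_pos (Nat.count_strict_mono a2 a1), Nat.nth_count a2]
      · have := Nat.count_strict_mono (p := fun x => ¬D x) a2 a1
        rw [if_neg a2, if_neg (by omega), if_neg (by omega), if_pos (by omega),
          Nat.add_sub_cancel_left, Nat.nth_count (p := fun x => ¬D x) a2]
    · rw [if_neg a1]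
      by_cases a2 : p < b + (a - Nat.count D b)
      · rw [if_pos a2, if_neg (by omega), if_pos (by omega)]
        omega
      · rw [if_neg a2, if_neg (by omega), if_neg (by omega), if_neg (by omega)]

section grass

variable {a b : ℕ} {D : ℕ → Prop} [DecidablePred D] {hc : Nat.count D b ≤ a} {q : ℕ}

theorem grass_apply_of_lt_count (h : q < Nat.count D b) : grass a b D hc q = Nat.nth D q :=
  if_pos h

theorem grass_apply_of_count_le (h : Nat.count D b ≤ q) (h' : q < a) :
    grass a b D hc q = b + (q - Nat.count D b) :=
  (if_neg (by omega)).trans (if_pos h')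

theorem grass_apply_of_le (h : a ≤ q) (h' : q < a + (b - Nat.count D b)) :
    grass a b D hc q = Nat.nth (fun x => ¬D x) (q - a) :=
  (if_neg (by omega)).trans ((if_neg (by omega)).trans (if_pos h'))

theorem grass_apply_of_ge (h : a + (b - Nat.count D b) ≤ q) : grass a b D hc q = q := by
  have := Nat.count_le (p := D) (n := b)
  exact (if_neg (by omega)).trans ((if_neg (by omega)).trans (if_neg (by omega)))

theorem grass_inv_apply_of_le (h : b ≤ q) :
    (grass a b D hc)⁻¹ q = if q < b + (a - Nat.count D b) then q - b + Nat.count D b else q :=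
  if_neg (by omega)

theorem grass_lt_of_lt {q' : ℕ} (h : q < q') (h' : q' < a) :
    grass a b D hc q < grass a b D hc q' := by
  by_cases h1 : q' < Nat.count D b
  · rw [grass_apply_of_lt_count h1, grass_apply_of_lt_count (h.trans h1)]
    exact nth_lt_nth_of_lt_count h1 h
  rw [grass_apply_of_count_le (not_lt.1 h1) h']
  by_cases h2 : q < Nat.count D b
  · rw [grass_apply_of_lt_count h2]
    have := (nth_spec h2).2.2
    omega
  · rw [grass_apply_of_count_le (not_lt.1 h2) (h.trans h')]
    omega

theorem isPartialPerm_grass : IsPartialPerm a b (grass a b D hc) := by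
  have h1 := count_add_count_not D b
  refine ⟨⟨a + b, fun k hk => grass_apply_of_ge (by omega)⟩, fun k hk => ?_, fun k hk => ?_⟩
  · by_cases a1 : k + 1 < a + (b - Nat.count D b)
    · rw [grass_apply_of_le hk (by omega), grass_apply_of_le (by omega) a1]
      exact nth_lt_nth_of_lt_count (b := b) (by omega) (by omega)
    · rw [grass_apply_of_ge (q := k + 1) (by omega)]
      by_cases a2 : k < a + (b - Nat.count D b)
      · rw [grass_apply_of_le hk a2]
        have := (nth_spec (D := fun x => ¬D x) (b := b) (q := k - a) (by omega)).2.2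
        omega
      · rw [grass_apply_of_ge (by omega)]
        omega
  · rw [grass_inv_apply_of_le hk, grass_inv_apply_of_le (by omega)]
    split_ifs <;> omega

end grass

/-- The count of the indices satisfying `B` in the enumeration of those satisfying `A`. -/
theorem count_nth_comp (A B : ℕ → Prop) [DecidablePred A] [DecidablePred B] (t : ℕ) :
    Nat.count (fun p => B (Nat.nth A p)) (Nat.count A t) = Nat.count (fun t => A t ∧ B t) t := by
  induction t with
  | zero => simp
  | succ t ih =>
    rw [Nat.count_succ, Nat.count_succ]
    by_cases hA : A t
    · rw [if_pos hA, Nat.count_succ, ih, Nat.nth_count hA]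
      simp [hA]
    · rw [if_neg hA, add_zero, ih]
      simp [hA]


/-! ### The product of the factors -/

/-- The dimension vector without its first entry. -/
abbrev shift (e : ℕ → ℕ) : ℕ → ℕ := fun i => e (i + 1)

theorem totalDim_succ (n : ℕ) (e : ℕ → ℕ) : totalDim (n + 1) e = totalDim n (shift e) + e 0 :=
  Finset.sum_range_succ' _ _

theorem totalDim_zero (e : ℕ → ℕ) : totalDim 0 e = e 0 := by simp [totalDim]

theorem le_totalDim (n : ℕ) (e : ℕ → ℕ) : e 0 ≤ totalDim n e := by
  cases n with
  | zero => rw [totalDim_zero]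
  | succ n => rw [totalDim_succ]; omega

theorem sum_range_add_le_totalDim {n j : ℕ} (e : ℕ → ℕ) (hj : j < n) :
    ∑ k ∈ Finset.range j, e k + (e j + e (j + 1)) ≤ totalDim n e := by
  rw [← add_assoc, ← Finset.sum_range_succ, ← Finset.sum_range_succ]
  exact Finset.sum_le_sum_of_subset (Finset.range_subset_range.2 (by omega))

theorem sum_Ioc_shift (n j : ℕ) (e : ℕ → ℕ) :
    ∑ k ∈ Finset.Ioc (j + 1) (n + 1), e k = ∑ k ∈ Finset.Ioc j n, shift e k := by
  rw [← Finset.Ico_succ_succ_eq_Ioc, ← Finset.Ico_succ_succ_eq_Ioc]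
  simp only [Nat.succ_eq_succ]
  exact (Finset.sum_Ico_add' e (j + 1) (n + 1) 1).symm

theorem sum_Ioc_zero (n : ℕ) (e : ℕ → ℕ) :
    ∑ k ∈ Finset.Ioc 0 (n + 1), e k = totalDim n (shift e) := by
  rw [← Finset.Ico_succ_succ_eq_Ioc, totalDim, Finset.range_eq_Ico]
  exact (Finset.sum_Ico_add' e 0 (n + 1) 1).symm

theorem sum_Ioo_shift (j i : ℕ) (e : ℕ → ℕ) :
    ∑ k ∈ Finset.Ioo (j + 1) (i + 1), e k = ∑ k ∈ Finset.Ioo j i, shift e k := by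
  rw [← Finset.Ico_succ_left_eq_Ioo, ← Finset.Ico_succ_left_eq_Ioo]
  exact (Finset.sum_Ico_add' e (j + 1) i 1).symm

theorem finSupp_blockSwap (m a b : ℕ) : FinSupp (blockSwap m a b) := by
  refine ⟨m + a + b, fun k hk => ?_⟩
  change (if k < m then k else if k < m + a then k + b else if k < m + a + b then k - a else k) = k
  split_ifs <;> omega

theorem blockSwap_apply (m a b x : ℕ) : blockSwap m a b x =
    if x < m then x else if x < m + a then x + b else if x < m + a + b then x - a else x := rfl

theorem blockSwap_inv_apply (m a b x : ℕ) : (blockSwap m a b)⁻¹ x =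
    if x < m then x else if x < m + b then x + a else if x < m + b + a then x - b else x := rfl

/-- Adjacent rectangles merge. No length is lost because the left one is increasing on the support
of the right one. -/
theorem of_blockSwap_mul (m a a' b : ℕ) :
    Hecke.of (blockSwap m a b) * Hecke.of (blockSwap (m + a) a' b) =
      Hecke.of (blockSwap m (a + a') b) := by
  apply Hecke.perm_injective
  rw [Hecke.perm_mul_of_strictMonoOn (l := m + a) (h := m + a + a' + b),
    Hecke.perm_of (finSupp_blockSwap _ _ _), Hecke.perm_of (finSupp_blockSwap _ _ _),
    Hecke.perm_of (finSupp_blockSwap _ _ _)]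
  · apply Equiv.ext
    intro x
    rw [Perm.mul_apply, blockSwap_apply, blockSwap_apply, blockSwap_apply]
    split_ifs <;> omega
  · rw [Hecke.perm_of (finSupp_blockSwap _ _ _)]
    intro k hk
    rw [blockSwap_apply]
    split_ifs <;> omega
  · rw [Hecke.perm_of (finSupp_blockSwap _ _ _)]
    intro x y _ _ _
    rw [blockSwap_apply, blockSwap_apply]
    split_ifs <;> omega

/-- The crossings of all dots of column `0` with all dots of the columns `2, …, n + 1`. -/
noncomputable def rect (n : ℕ) (e : ℕ → ℕ) : Hecke :=
  Hecke.of (blockSwap (e 1) (totalDim n (shift e) - e 1) (e 0))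

theorem perm_rect (n : ℕ) (e : ℕ → ℕ) :
    Hecke.perm (rect n e) = blockSwap (e 1) (totalDim n (shift e) - e 1) (e 0) :=
  Hecke.perm_of (finSupp_blockSwap _ _ _)

theorem sum_Ioo_succ (m : ℕ) (e : ℕ → ℕ) :
    ∑ k ∈ Finset.Ioo 0 (m + 2), e k = totalDim m (shift e) := by
  rw [← Finset.Ico_succ_left_eq_Ioo, totalDim, Finset.range_eq_Ico]
  exact (Finset.sum_Ico_add' e 0 (m + 1) 1).symm

theorem prod_blockSwap (m : ℕ) (e : ℕ → ℕ) :
    ((List.range' 2 m).map fun i =>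
      Hecke.of (blockSwap (∑ k ∈ Finset.Ioo 0 i, e k) (e i) (e 0))).prod = rect m e := by
  induction m with
  | zero =>
    apply Hecke.perm_injective
    have h0 : shift e 0 = e 1 := rfl
    rw [perm_rect, totalDim_zero, h0]
    apply Equiv.ext
    intro x
    rw [blockSwap_apply]
    simp only [List.range'_zero, List.map_nil, List.prod_nil, Hecke.perm_one, Perm.one_apply]
    split_ifs <;> omega
  | succ m ih =>
    have h1 : e 1 ≤ totalDim m (shift e) := le_totalDim m (shift e)
    have h2 : totalDim (m + 1) (shift e) = totalDim m (shift e) + e (2 + m) := by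
      rw [totalDim, Finset.sum_range_succ, add_comm 2 m]; rfl
    rw [List.range'_concat, List.map_append, List.prod_append, ih, List.map_singleton,
      List.prod_singleton, rect, rect, one_mul, add_comm 2 m, sum_Ioo_succ]
    have h3 : totalDim m (shift e) = e 1 + (totalDim m (shift e) - e 1) := by omega
    nth_rw 2 [h3]
    rw [of_blockSwap_mul, h2, add_comm 2 m]
    congr 2
    omega

/-- The product in the 0-Hecke monoid of the factors `x 0, …, x (n - 1)` and the rectangles. -/
noncomputable def hProd : ∀ (n : ℕ) (_ : ℕ → ℕ) (_ : Fin n → Hecke), Hecke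
  | 0, _, _ => 1
  | n + 1, e, x => x 0 * rect n e * hProd n (shift e) fun j => x j.succ

/-- Peels off column `0`. The inductions on `n` below use the same splitting into a head and a tail
for `shift e`. -/
theorem factorList_succ (n : ℕ) (e : ℕ → ℕ) (w : Fin (n + 1) → Perm ℕ) :
    factorList (n + 1) e w = (w 0 :: (List.range' 2 n).map fun i =>
      blockSwap (∑ k ∈ Finset.Ioo 0 i, e k) (e i) (e 0)) ++
        factorList n (shift e) fun j => w j.succ := by
  rw [factorList, List.finRange_succ, List.flatMap_cons]
  congr 1
  rw [factorList, List.flatMap_map]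
  congr 1
  funext j
  congr 1
  have h1 : List.range' ((j.succ : ℕ) + 2) (n + 1 - 1 - (j.succ : ℕ)) =
      (List.range' ((j : ℕ) + 2) (n - 1 - j)).map (1 + ·) := by
    rw [List.map_add_range']
    congr 1
    · simp only [Fin.val_succ]; omega
    · simp only [Fin.val_succ]; omega
  rw [h1, List.map_map]
  apply List.map_congr_left
  intro i _
  simp only [Function.comp_apply, Fin.val_succ, add_comm 1 i, sum_Ioo_shift]

theorem factorList_prod (n : ℕ) (e : ℕ → ℕ) (w : Fin n → Perm ℕ) :
    ((factorList n e w).map Hecke.of).prod = hProd n e fun j => Hecke.of (w j) := by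
  induction n generalizing e with
  | zero => rfl
  | succ n ih =>
    rw [factorList_succ, List.map_append, List.prod_append, ih, List.map_cons, List.prod_cons,
      List.map_map, hProd, ← prod_blockSwap]
    rfl

theorem finSupp_of_mem_factorList {n : ℕ} {e : ℕ → ℕ} {w : Fin n → Perm ℕ}
    (hw : ∀ j, FinSupp (w j)) {u : Perm ℕ} (hu : u ∈ factorList n e w) : FinSupp u := by
  simp only [factorList, List.mem_flatMap, List.mem_cons, List.mem_map] at hu
  obtain ⟨j, -, rfl | ⟨i, -, rfl⟩⟩ := hu
  · exact hw j
  · exact finSupp_blockSwap _ _ _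

/-- Each `w j` is in the symmetric group on `e j + e (j + 1)` letters. -/
def InRange (n : ℕ) (e : ℕ → ℕ) (w : Fin n → Perm ℕ) : Prop :=
  ∀ j : Fin n, FixesOutside 0 (e j + e (j + 1)) (w j)

theorem InRange.finSupp {n : ℕ} {e : ℕ → ℕ} {w : Fin n → Perm ℕ} (hw : InRange n e w)
    (j : Fin n) : FinSupp (w j) := ⟨_, hw j⟩

theorem IsLaceDiagram.inRange {n : ℕ} {e : ℕ → ℕ} {w : Fin n → Perm ℕ}
    (hw : IsLaceDiagram n e w) : InRange n e w := fun j =>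
  (hw j).fixesOutside.mono le_rfl (by omega)

theorem InRange.tail {n : ℕ} {e : ℕ → ℕ} {w : Fin (n + 1) → Perm ℕ} (hw : InRange (n + 1) e w) :
    InRange n (shift e) fun j => w j.succ := fun j => hw j.succ

/-- The Hecke product of the factors. -/
noncomputable def factorProd (n : ℕ) (e : ℕ → ℕ) (w : Fin n → Perm ℕ) : Hecke :=
  hProd n e fun j => Hecke.of (w j)

theorem isHeckeProduct_factorList {n : ℕ} {e : ℕ → ℕ} {w : Fin n → Perm ℕ}
    (hw : ∀ j, FinSupp (w j)) (z : Perm ℕ) :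
    IsHeckeProduct (factorList n e w) z ↔ Hecke.perm (factorProd n e w) = z := by
  rw [isHeckeProduct_iff fun u hu => finSupp_of_mem_factorList hw hu, factorList_prod]
  rfl

theorem factorProd_succ (n : ℕ) (e : ℕ → ℕ) (w : Fin (n + 1) → Perm ℕ) :
    factorProd (n + 1) e w =
      Hecke.of (w 0) * rect n e * factorProd n (shift e) fun j => w j.succ := rfl

/-- The rectangle keeps the order of the wires on which `u` acts: its inverse is increasing on `[0,
e 0 + e 1)`, so the Hecke product is the ordinary one. -/
theorem perm_of_mul_rect {n : ℕ} {e : ℕ → ℕ} {u : Perm ℕ}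
    (hu : FixesOutside 0 (e 0 + e 1) u) :
    Hecke.perm (Hecke.of u * rect n e) =
      u * blockSwap (e 1) (totalDim n (shift e) - e 1) (e 0) := by
  have hf : Hecke.perm (Hecke.of u) = u := Hecke.perm_of ⟨_, hu⟩
  rw [Hecke.perm_mul_of_strictMonoOn_inv (l := 0) (h := e 0 + e 1), hf, perm_rect]
  · rwa [hf]
  · intro x y _ _ _
    rw [perm_rect, blockSwap_inv_apply, blockSwap_inv_apply]
    split_ifs <;> omega

section head

variable {n : ℕ} {e : ℕ → ℕ} {u : Perm ℕ} {y : ℕ}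

theorem head_apply_of_lt (hu : FixesOutside 0 (e 0 + e 1) u) (hy : y < e 1) :
    Hecke.perm (Hecke.of u * rect n e) y = u y := by
  rw [perm_of_mul_rect hu, Perm.mul_apply, blockSwap_apply, if_pos hy]

theorem head_apply_of_le (hu : FixesOutside 0 (e 0 + e 1) u) (hy : e 1 ≤ y)
    (hy' : y < totalDim n (shift e)) :
    Hecke.perm (Hecke.of u * rect n e) y = y + e 0 := by
  rw [perm_of_mul_rect hu, Perm.mul_apply, blockSwap_apply, if_neg (by omega), if_pos (by omega)]
  exact hu _ (by omega)

theorem head_apply_last (hu : FixesOutside 0 (e 0 + e 1) u) (hy : y < e 0) :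
    Hecke.perm (Hecke.of u * rect n e) (totalDim n (shift e) + y) = u (e 1 + y) := by
  have : e 1 ≤ totalDim n (shift e) := le_totalDim n (shift e)
  rw [perm_of_mul_rect hu, Perm.mul_apply, blockSwap_apply, if_neg (by omega), if_neg (by omega),
    if_pos (by omega)]
  congr 1
  omega

theorem fixesOutside_head (hu : FixesOutside 0 (e 0 + e 1) u) :
    FixesOutside 0 (totalDim (n + 1) e) (Hecke.perm (Hecke.of u * rect n e)) := by
  have : e 1 ≤ totalDim n (shift e) := le_totalDim n (shift e)
  rw [totalDim_succ]
  apply Hecke.fixesOutside_mul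
  · rw [Hecke.perm_of ⟨_, hu⟩]
    exact hu.mono le_rfl (by omega)
  · rw [perm_rect]
    intro k hk
    rw [blockSwap_apply]
    split_ifs <;> omega

end head

theorem fixesOutside_factorProd {n : ℕ} {e : ℕ → ℕ} {w : Fin n → Perm ℕ} (hw : InRange n e w) :
    FixesOutside 0 (totalDim n e) (Hecke.perm (factorProd n e w)) := by
  induction n generalizing e with
  | zero => exact FixesOutside.one _ _
  | succ n ih =>
    rw [factorProd_succ]
    refine Hecke.fixesOutside_mul (fixesOutside_head (hw 0)) ((ih hw.tail).mono le_rfl ?_)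
    rw [totalDim_succ]
    omega

/-! ### Descents of the factors and of the product -/

/-- A descent of `w j` past the dots of column `j + 1` survives to the product. It concerns wires
that leave at column `j`, whose places all later factors fix, so the generator slides left to `w j`
and is absorbed. -/
theorem factorProd_mul_gen {n : ℕ} {e : ℕ → ℕ} {w : Fin n → Perm ℕ} (hw : InRange n e w)
    (j : Fin n) {k : ℕ} (hk : k + 1 < e j) (hd : w j (e (j + 1) + k + 1) < w j (e (j + 1) + k)) :
    factorProd n e w * Hecke.gen (∑ i ∈ Finset.Ioc (j : ℕ) n, e i + k) = factorProd n e w := by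
  induction n generalizing e with
  | zero => exact j.elim0
  | succ n ih =>
    rw [factorProd_succ]
    rcases Fin.eq_zero_or_eq_succ j with rfl | ⟨j, rfl⟩
    · simp only [Fin.val_zero, zero_add] at hk hd ⊢
      have hQ := fixesOutside_factorProd hw.tail
      have hX : Hecke.of (w 0) * rect n e * Hecke.gen (totalDim n (shift e) + k) =
          Hecke.of (w 0) * rect n e := by
        rw [Hecke.mul_gen_eq_self_iff, add_assoc, head_apply_last (hw 0) hk,
          head_apply_last (hw 0) (by omega)]
        exact hd
      rw [sum_Ioc_zero, mul_assoc, ← Hecke.gen_mul_eq_mul_gen (hQ _ (by omega)) (hQ _ (by omega)),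
        ← mul_assoc, hX]
    · rw [Fin.val_succ, sum_Ioc_shift, mul_assoc]
      congr 1
      exact ih hw.tail j hk hd

/-- The counterpart for wires that enter at column `j + 1`: the generator slides right through the
earlier factors, which only shift these wires. -/
theorem gen_mul_factorProd {n : ℕ} {e : ℕ → ℕ} {w : Fin n → Perm ℕ} (hw : InRange n e w)
    (j : Fin n) {k : ℕ} (hk : e j ≤ k) (hk' : k + 1 < e j + e (j + 1))
    (hd : (w j)⁻¹ (k + 1) < (w j)⁻¹ k) :
    Hecke.gen (∑ i ∈ Finset.range j, e i + k) * factorProd n e w = factorProd n e w := by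
  induction n generalizing e with
  | zero => exact j.elim0
  | succ n ih =>
    rw [factorProd_succ]
    rcases Fin.eq_zero_or_eq_succ j with rfl | ⟨j, rfl⟩
    · have : Hecke.gen k * Hecke.of (w 0) = Hecke.of (w 0) := by
        rw [Hecke.gen_mul_eq_self_iff, Hecke.perm_of (hw.finSupp 0)]
        exact hd
      simp only [Fin.val_zero, Finset.range_zero, Finset.sum_empty, zero_add]
      rw [← mul_assoc, ← mul_assoc, this]
    · have h1 := ih hw.tail j hk hk' hd
      have h2 : ∑ i ∈ Finset.range j, shift e i + (e (j + 1) + e (j + 1 + 1)) ≤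
          totalDim n (shift e) := sum_range_add_le_totalDim (shift e) j.isLt
      -- The place lies beyond the dots of column `1`, where the head is the shift by `e 0`.
      have h3 : e 1 ≤ ∑ i ∈ Finset.range j, shift e i + k := by
        rcases Nat.eq_zero_or_pos (j : ℕ) with h0 | h0
        · simp only [Fin.val_succ, h0, zero_add] at hk
          omega
        · have := Finset.single_le_sum (f := shift e) (fun _ _ => Nat.zero_le _)
            (Finset.mem_range.2 h0)
          simp only [shift, zero_add] at this ⊢
          omega
      rw [Fin.val_succ, Finset.sum_range_succ', show
        ∑ i ∈ Finset.range j, e (i + 1) + e 0 + k = ∑ i ∈ Finset.range j, shift e i + k + e 0 by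
          simp only [shift]; omega, ← mul_assoc, Hecke.gen_mul_eq_mul_gen
          (k := ∑ i ∈ Finset.range j, shift e i + k), mul_assoc, h1]
      · exact head_apply_of_le (hw 0) h3 (by simp only [Fin.val_succ] at hk'; omega)
      · rw [head_apply_of_le (hw 0) (by omega) (by simp only [Fin.val_succ] at hk'; omega)]
        omega

theorem factorProd_mul_gen_last {n : ℕ} {e : ℕ → ℕ} {w : Fin n → Perm ℕ} (hw : InRange n e w)
    (j : Fin n) (hj : (j : ℕ) + 1 = n) {k : ℕ} (hk : k + 1 < e n) (hd : w j (k + 1) < w j k) :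
    factorProd n e w * Hecke.gen k = factorProd n e w := by
  induction n generalizing e with
  | zero => exact j.elim0
  | succ n ih =>
    rw [factorProd_succ]
    rcases Fin.eq_zero_or_eq_succ j with rfl | ⟨j, rfl⟩
    · obtain rfl : n = 0 := by simpa using hj.symm
      rw [zero_add] at hk
      change Hecke.of (w 0) * rect 0 e * 1 * Hecke.gen k = Hecke.of (w 0) * rect 0 e * 1
      rw [mul_one, Hecke.mul_gen_eq_self_iff, head_apply_of_lt (hw 0) hk,
        head_apply_of_lt (hw 0) (by omega)]
      exact hd
    · rw [mul_assoc]
      congr 1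
      exact ih hw.tail j (by simpa using hj) hk hd

/-- `z` has no descents in the interior of the blocks of positions, and its inverse has none
in the interior of the blocks of values. -/
def BlockMono (n : ℕ) (e : ℕ → ℕ) (z : Perm ℕ) : Prop :=
  (∀ j, j ≤ n → ∀ k, k + 1 < e j →
    z (∑ i ∈ Finset.Ioc j n, e i + k) < z (∑ i ∈ Finset.Ioc j n, e i + k + 1)) ∧
  (∀ i, i ≤ n → ∀ k, k + 1 < e i →
    z⁻¹ (∑ l ∈ Finset.range i, e l + k) < z⁻¹ (∑ l ∈ Finset.range i, e l + k + 1))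

/-- A forbidden descent of a factor would be a descent of the product, or of its inverse, in the
interior of a block. This is why being a lace diagram need not be assumed of a KMS-factorization. -/
theorem isLaceDiagram_of_blockMono {n : ℕ} {e : ℕ → ℕ} {w : Fin n → Perm ℕ} (hw : InRange n e w)
    (hz : BlockMono n e (Hecke.perm (factorProd n e w))) : IsLaceDiagram n e w := by
  intro j
  refine ⟨⟨_, fun k hk => hw j k (Or.inr hk)⟩, fun k hk => ?_, fun k hk => ?_⟩
  · have hne : w j k ≠ w j (k + 1) := by simp
    by_contra hc
    by_cases hlt : k + 1 < e j + e (j + 1)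
    · obtain ⟨k, rfl⟩ := Nat.exists_eq_add_of_le hk
      have h1 := factorProd_mul_gen hw j (k := k) (by omega) (by omega)
      rw [Hecke.mul_gen_eq_self_iff] at h1
      have h2 := hz.1 j j.isLt.le k (by omega)
      omega
    · rw [hw j (k + 1) (Or.inr (by omega))] at hc
      by_cases hlt : k < e j + e (j + 1)
      · have := (hw j).apply_mem (k := k) (by omega)
        omega
      · rw [hw j k (Or.inr (by omega))] at hc
        omega
  · have hne : (w j)⁻¹ k ≠ (w j)⁻¹ (k + 1) := fun h => by
      have := (w j)⁻¹.injective h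
      omega
    by_contra hc
    by_cases hlt : k + 1 < e j + e (j + 1)
    · have h1 := gen_mul_factorProd hw j hk hlt (by omega)
      rw [Hecke.gen_mul_eq_self_iff] at h1
      have h2 := hz.2 (j + 1) j.isLt (k - e j) (by omega)
      rw [Finset.sum_range_succ, show ∑ x ∈ Finset.range ↑j, e x + e ↑j + (k - e ↑j) =
        ∑ x ∈ Finset.range ↑j, e x + k by omega] at h2
      omega
    · rw [(hw j).inv (k + 1) (Or.inr (by omega))] at hc
      by_cases hlt : k < e j + e (j + 1)
      · have := (hw j).inv.apply_mem (k := k) (by omega)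
        omega
      · rw [(hw j).inv k (Or.inr (by omega))] at hc
        omega

/-! ### Moves preserve the product -/

/-- The rectangle begins after the dots of column `1`, so crossings among these dots commute with
it. -/
theorem rect_mul_gen {n : ℕ} {e : ℕ → ℕ} {k : ℕ} (hk : k + 1 < e 1) :
    rect n e * Hecke.gen k = Hecke.gen k * rect n e := by
  symm
  apply Hecke.gen_mul_eq_mul_gen
  · rw [perm_rect, blockSwap_apply, if_pos (by omega)]
  · rw [perm_rect, blockSwap_apply, if_pos hk]

/-- A crossing may slide from one side of a column to the other. -/
theorem hProd_slide {n : ℕ} {e : ℕ → ℕ} {x y : Fin n → Hecke} {i i' : Fin n} {k : ℕ} {a b : Hecke}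
    (hi : (i' : ℕ) = i + 1) (hk : k + 1 < e i') (hx : x i = a * Hecke.gen k) (hx' : x i' = b)
    (hy : y i = a) (hy' : y i' = Hecke.gen k * b) (h : ∀ j, j ≠ i → j ≠ i' → x j = y j) :
    hProd n e x = hProd n e y := by
  induction n generalizing e with
  | zero => exact i.elim0
  | succ n ih =>
    obtain ⟨i', rfl⟩ : ∃ l : Fin n, i' = l.succ := by
      rcases Fin.eq_zero_or_eq_succ i' with rfl | h
      · simp at hi
      · exact h
    rcases Fin.eq_zero_or_eq_succ i with rfl | ⟨i, rfl⟩
    · cases n with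
      | zero => exact i'.elim0
      | succ n =>
        obtain rfl : i' = 0 := by
          apply Fin.ext
          simpa using hi
        have ht : (fun j : Fin n => x j.succ.succ) = fun j : Fin n => y j.succ.succ := by
          funext j
          apply h
          · exact Fin.succ_ne_zero _
          · intro h0
            exact Fin.succ_ne_zero _ (Fin.succ_injective _ h0)
        have hk' : k + 1 < e 1 := hk
        simp only [hProd]
        rw [hx, hx', hy, hy', ht]
        simp only [mul_assoc]
        rw [← mul_assoc (rect (n + 1) e) (Hecke.gen k), rect_mul_gen hk', mul_assoc]
    · rw [hProd, hProd, h 0 (Fin.succ_ne_zero _).symm (Fin.succ_ne_zero _).symm]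
      congr 1
      refine ih (i := i) (i' := i') (by simpa using hi) hk hx hx' hy hy' fun j hj hj' => ?_
      exact h _ (fun h => hj (Fin.succ_injective _ h)) fun h => hj' (Fin.succ_injective _ h)

theorem finSupp_mul_simpleSwap {u : Perm ℕ} (hu : FinSupp u) (k : ℕ) :
    FinSupp (u * simpleSwap k) := by
  obtain ⟨N, hN⟩ := hu
  exact ⟨max N (k + 2), (hN.mono le_rfl (le_max_left _ _)).mul
    (FixesOutside.simpleSwap (by omega) (by omega))⟩

theorem finSupp_simpleSwap_mul {u : Perm ℕ} (hu : FinSupp u) (k : ℕ) :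
    FinSupp (simpleSwap k * u) := by
  obtain ⟨N, hN⟩ := hu
  exact ⟨max N (k + 2), (FixesOutside.simpleSwap (by omega) (by omega)).mul
    (hN.mono le_rfl (le_max_left _ _))⟩

theorem of_mul_simpleSwap {u : Perm ℕ} (hu : FinSupp u) {k : ℕ} (h : u k < u (k + 1)) :
    Hecke.of (u * simpleSwap k) = Hecke.of u * Hecke.gen k := by
  apply Hecke.of_eq
  have := Hecke.perm_of hu
  rw [Hecke.perm_mul_gen_of_lt (by rwa [this]), this]

theorem of_simpleSwap_mul {u : Perm ℕ} (hu : FinSupp u) {k : ℕ} (h : u⁻¹ k < u⁻¹ (k + 1)) :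
    Hecke.of (simpleSwap k * u) = Hecke.gen k * Hecke.of u := by
  apply Hecke.of_eq
  have := Hecke.perm_of hu
  rw [Hecke.perm_gen_mul_of_lt (by rwa [this]), this]

/-- Around the column the three diagrams read `a * g, b` and `a, g * b` and `a * g, g * b`; they
agree by sliding `g` across and by `g * g = g`. -/
theorem factorProd_inTriple {n : ℕ} {e : ℕ → ℕ} {u : Fin n → Perm ℕ} {i i' : Fin n} {j : ℕ}
    {w : Fin n → Perm ℕ} (hi : (i' : ℕ) = i + 1) (hj : j + 1 < e i')
    (h1 : u i j < u i (j + 1)) (h2 : (u i')⁻¹ j < (u i')⁻¹ (j + 1))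
    (hu : FinSupp (u i)) (hu' : FinSupp (u i')) (h : InTriple u i i' j w) :
    factorProd n e w = factorProd n e (Function.update u i (u i * simpleSwap j)) := by
  have hne : i ≠ i' := by rintro rfl; omega
  -- The diagram crossed only on the right serves as reference; the other two both slide to it.
  have key : ∀ w', w' i = u i → w' i' = simpleSwap j * u i' → (∀ l, l ≠ i → l ≠ i' → w' l = u l) →
      ∀ w'', w'' i = u i * simpleSwap j → w'' i' = u i' ∨ w'' i' = simpleSwap j * u i' →
      (∀ l, l ≠ i → l ≠ i' → w'' l = u l) → factorProd n e w'' = factorProd n e w' := by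
    intro w' a1 a2 a3 w'' b1 b2 b3
    refine hProd_slide (i := i) (i' := i') (k := j) (a := Hecke.of (u i)) hi hj ?_ rfl ?_ ?_ ?_
    · rw [b1, of_mul_simpleSwap hu h1]
    · rw [a1]
    · rw [a2]
      rcases b2 with b2 | b2
      · rw [b2, of_simpleSwap_mul hu' h2]
      · rw [b2, of_simpleSwap_mul hu' h2, ← mul_assoc, Hecke.gen_mul_gen_self]
    · intro l hl hl'
      rw [a3 l hl hl', b3 l hl hl']
  have key' := key (Function.update u i' (simpleSwap j * u i'))
    (Function.update_of_ne hne _ _) (Function.update_self _ _ _)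
    (fun l _ hl' => Function.update_of_ne hl' _ _)
  have e1 := key' (Function.update u i (u i * simpleSwap j)) (Function.update_self _ _ _)
    (Or.inl (Function.update_of_ne hne.symm _ _)) (fun l hl _ => Function.update_of_ne hl _ _)
  rcases h with rfl | rfl | rfl
  · rfl
  · exact e1.symm
  · rw [e1]
    apply key'
    · rw [Function.update_of_ne hne, Function.update_self]
    · right
      rw [Function.update_self]
    · intro l hl hl'
      rw [Function.update_of_ne hl', Function.update_of_ne hl]

/-- The auxiliary `u` of a move need not be a lace diagram, so finite support of its two factors is
inherited from `w`. -/
theorem finSupp_of_inTriple {n : ℕ} {u w : Fin n → Perm ℕ} {i i' : Fin n} {j : ℕ}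
    (hne : i ≠ i') (hw : ∀ l, FinSupp (w l)) (h : InTriple u i i' j w) :
    FinSupp (u i) ∧ FinSupp (u i') := by
  have hr : ∀ v : Perm ℕ, FinSupp (v * simpleSwap j) → FinSupp v := fun v hv => by
    have := finSupp_mul_simpleSwap hv j
    rwa [mul_assoc, simpleSwap_mul_self, mul_one] at this
  have hl : ∀ v : Perm ℕ, FinSupp (simpleSwap j * v) → FinSupp v := fun v hv => by
    have := finSupp_simpleSwap_mul hv j
    rwa [← mul_assoc, simpleSwap_mul_self, one_mul] at this
  have h1 := hw i
  have h2 := hw i'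
  rcases h with rfl | rfl | rfl
  · rw [Function.update_self] at h1
    rw [Function.update_of_ne hne.symm] at h2
    exact ⟨hr _ h1, h2⟩
  · rw [Function.update_of_ne hne] at h1
    rw [Function.update_self] at h2
    exact ⟨h1, hl _ h2⟩
  · rw [Function.update_of_ne hne, Function.update_self] at h1
    rw [Function.update_self] at h2
    exact ⟨hr _ h1, hl _ h2⟩

theorem KMove.factorProd_eq {n : ℕ} {e : ℕ → ℕ} {w w' : Fin n → Perm ℕ} (h : KMove n e w w') :
    factorProd n e w = factorProd n e w' := by
  obtain ⟨hw, hw', i, i', j, u, hi, hj, h1, h2, ht, ht'⟩ := h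
  have hne : i ≠ i' := by rintro rfl; omega
  obtain ⟨hu, hu'⟩ := finSupp_of_inTriple hne hw.inRange.finSupp ht
  rw [factorProd_inTriple hi hj h1 h2 hu hu' ht, factorProd_inTriple hi hj h1 h2 hu hu' ht']

theorem KMove.symm {n : ℕ} {e : ℕ → ℕ} {w w' : Fin n → Perm ℕ} (h : KMove n e w w') :
    KMove n e w' w := by
  obtain ⟨hw, hw', i, i', j, u, hi, hj, h1, h2, ht, ht'⟩ := h
  exact ⟨hw', hw, i, i', j, u, hi, hj, h1, h2, ht', ht⟩

/-! ### Sequences without descents at the dots -/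

/-- No `w j` has a descent strictly between two dots of column `j + 1`. -/
def IsNormal (n : ℕ) (e : ℕ → ℕ) (w : Fin n → Perm ℕ) : Prop :=
  ∀ j : Fin n, ∀ k, k + 1 < e (j + 1) → w j k < w j (k + 1)

theorem IsNormal.tail {n : ℕ} {e : ℕ → ℕ} {w : Fin (n + 1) → Perm ℕ} (hw : IsNormal (n + 1) e w) :
    IsNormal n (shift e) fun j => w j.succ := fun j => hw j.succ

/-- Wires on dots of column `1` land below `e 0 + e 1`, the later ones are shifted to `e 0 + e 1` or
beyond. So monotonicity at the dots spreads to the whole support of the tail, and the Hecke product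
becomes the ordinary one. -/
theorem head_lt_head {n : ℕ} {e : ℕ → ℕ} {u : Perm ℕ} (hu : FixesOutside 0 (e 0 + e 1) u)
    (hm : ∀ k, k + 1 < e 1 → u k < u (k + 1)) {a b : ℕ} (hab : a < b)
    (hb : b < totalDim n (shift e)) :
    Hecke.perm (Hecke.of u * rect n e) a < Hecke.perm (Hecke.of u * rect n e) b := by
  by_cases h1 : b < e 1
  · rw [head_apply_of_lt hu h1, head_apply_of_lt hu (hab.trans h1)]
    exact lt_of_forall_lt_succ_Ico (a := 0) (fun k _ => hm k) (Nat.zero_le _) hab h1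
  rw [head_apply_of_le hu (not_lt.1 h1) hb]
  by_cases h2 : a < e 1
  · rw [head_apply_of_lt hu h2]
    have := hu.apply_mem (k := a) (by omega)
    omega
  · rw [head_apply_of_le hu (not_lt.1 h2) (by omega)]
    omega

theorem IsNormal.perm_factorProd_succ {n : ℕ} {e : ℕ → ℕ} {w : Fin (n + 1) → Perm ℕ}
    (hr : InRange (n + 1) e w) (hw : IsNormal (n + 1) e w) :
    Hecke.perm (factorProd (n + 1) e w) = Hecke.perm (Hecke.of (w 0) * rect n e) *
      Hecke.perm (factorProd n (shift e) fun j => w j.succ) := by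
  rw [factorProd_succ]
  exact Hecke.perm_mul_of_strictMonoOn (fixesOutside_factorProd hr.tail)
    fun a b _ hab hb => head_lt_head (hr 0) (hw 0) hab hb

/-- Agreement from `a` on leaves the same set of values for `[0, a)`, and a set has only one
increasing enumeration. -/
theorem eq_of_eq_on_tail {a : ℕ} {u v : Perm ℕ} (hu : ∀ k, k + 1 < a → u k < u (k + 1))
    (hv : ∀ k, k + 1 < a → v k < v (k + 1)) (h : ∀ k, a ≤ k → u k = v k) : u = v := by
  suffices h1 : v⁻¹ * u = 1 by
    rw [inv_mul_eq_one] at h1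
    exact h1.symm
  have hfix : FixesOutside 0 a (v⁻¹ * u) := by
    intro k hk
    rw [Perm.mul_apply, h k (by omega), inv_apply_self']
  have hlt : ∀ x y, x < a → y < a → v x < v y → x < y := by
    intro x y hx _ hxy
    by_contra hc
    rcases (not_lt.1 hc).eq_or_lt with rfl | hc
    · omega
    · have := lt_of_forall_lt_succ_Ico (a := 0) (f := v) (fun k _ => hv k) (Nat.zero_le y) hc hx
      omega
  by_contra hne
  obtain ⟨k, -, hk, hd⟩ := exists_descent hfix hne
  have h1 := hfix.apply_mem (k := k) (by omega)
  have h2 := hfix.apply_mem (k := k + 1) (by omega)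
  have h3 := hlt _ _ h1.2 h2.2 (by
    rw [Perm.mul_apply, Perm.mul_apply, apply_inv_self', apply_inv_self']
    exact hu k hk)
  omega

/-- The tail fixes the last `e 0` positions, so there the product shows `w 0` beyond the dots of
column `1`; monotonicity gives the rest of `w 0`, and the head cancels in the group. -/
theorem IsNormal.eq_of_factorProd_eq {n : ℕ} {e : ℕ → ℕ} {w w' : Fin n → Perm ℕ}
    (hr : InRange n e w) (hw : IsNormal n e w) (hr' : InRange n e w') (hw' : IsNormal n e w')
    (h : factorProd n e w = factorProd n e w') : w = w' := by
  induction n generalizing e with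
  | zero => exact Subsingleton.elim _ _
  | succ n ih =>
    have hp := congrArg Hecke.perm h
    rw [hw.perm_factorProd_succ hr, hw'.perm_factorProd_succ hr'] at hp
    have h0 : w 0 = w' 0 := by
      refine eq_of_eq_on_tail (hw 0) (hw' 0) fun k hk => ?_
      simp only [Fin.val_zero, zero_add] at hk
      by_cases hlt : k < e 0 + e 1
      · have h1 := congrArg (fun f : Perm ℕ => f (totalDim n (shift e) + (k - e 1))) hp
        simp only [Perm.mul_apply] at h1
        rw [fixesOutside_factorProd hr.tail _ (by omega),
          fixesOutside_factorProd hr'.tail _ (by omega), head_apply_last (hr 0) (by omega),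
          head_apply_last (hr' 0) (by omega), show e 1 + (k - e 1) = k by omega] at h1
        exact h1
      · rw [hr 0 k (by simp; omega), hr' 0 k (by simp; omega)]
    rw [h0, mul_right_inj] at hp
    have h1 := ih hr.tail hw.tail hr'.tail hw'.tail (Hecke.perm_injective hp)
    funext j
    rcases Fin.eq_zero_or_eq_succ j with rfl | ⟨j, rfl⟩
    · exact h0
    · exact congrFun h1 j

/-- Moving crossings to the right leads to a sequence without descents at the dots. -/
theorem exists_isNormal {n : ℕ} {e : ℕ → ℕ} {w : Fin n → Perm ℕ} (hr : InRange n e w)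
    (hz : BlockMono n e (Hecke.perm (factorProd n e w))) :
    ∃ w', Relation.ReflTransGen (KMove n e) w w' ∧ InRange n e w' ∧ IsNormal n e w' ∧
      factorProd n e w' = factorProd n e w := by
  -- Crossings weigh less in later factors, so moving one to the right lowers the sum even if the
  -- next factor grows by one.
  induction hs : ∑ j : Fin n, (n - j) * wordLength (w j) using Nat.strong_induction_on
    generalizing w with
  | _ s ih =>
  by_cases hn : IsNormal n e w
  · exact ⟨w, .refl, hr, hn, rfl⟩
  simp only [IsNormal, not_forall, exists_prop, not_lt] at hn
  obtain ⟨i, k, hk, hd⟩ := hn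
  have hd : w i (k + 1) < w i k := lt_of_le_of_ne hd (by simp)
  -- In the last factor the descent would be a descent of the product inside its first block of
  -- positions.
  have hi : (i : ℕ) + 1 < n := by
    by_contra hc
    have hin : (i : ℕ) + 1 = n := by omega
    have h1 := factorProd_mul_gen_last hr i hin (k := k) (by rwa [← hin]) hd
    rw [Hecke.mul_gen_eq_self_iff] at h1
    have h2 := hz.1 n le_rfl k (by rwa [← hin])
    simp only [Finset.Ioc_self, Finset.sum_empty, zero_add] at h2
    omega
  obtain ⟨i', hi'⟩ : ∃ i' : Fin n, (i' : ℕ) = i + 1 := ⟨⟨i + 1, hi⟩, rfl⟩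
  have hne : i ≠ i' := by rintro rfl; omega
  -- the three diagrams of the move are those of `u`
  set a := w i * simpleSwap k with ha
  have haw : a * simpleSwap k = w i := by rw [ha, mul_assoc, simpleSwap_mul_self, mul_one]
  have hai : a k < a (k + 1) := by simpa [ha] using hd
  have hfa : FixesOutside 0 (e i + e (i + 1)) a :=
    (hr i).mul (FixesOutside.simpleSwap (by omega) (by omega))
  -- Here `b` is the next factor with the wires `k`, `k + 1` uncrossed. The crossing taken from `w
  -- i` is either transferred to it or merged with one already there.
  have main : ∀ b : Perm ℕ, FixesOutside 0 (e i' + e (i' + 1)) b → b⁻¹ k < b⁻¹ (k + 1) →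
      (w i' = b ∨ w i' = simpleSwap k * b) →
      (n - i') * wordLength (simpleSwap k * b) < (n - i') * wordLength (w i') + (n - i) →
      ∃ w', Relation.ReflTransGen (KMove n e) w w' ∧ InRange n e w' ∧ IsNormal n e w' ∧
        factorProd n e w' = factorProd n e w := by
    intro b hb hbk hbw hlen
    set u := Function.update (Function.update w i a) i' b with hu
    have hui : u i = a := by rw [hu, Function.update_of_ne hne, Function.update_self]
    have hui' : u i' = b := Function.update_self _ _ _
    set w₁ := Function.update u i' (simpleSwap k * u i') with hw₁
    have hw₁i : w₁ i = a := by rw [hw₁, Function.update_of_ne hne, hui]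
    have hw₁i' : w₁ i' = simpleSwap k * b := by rw [hw₁, Function.update_self, hui']
    have hw₁l : ∀ l, l ≠ i → l ≠ i' → w₁ l = w l := fun l hl hl' => by
      rw [hw₁, Function.update_of_ne hl', hu, Function.update_of_ne hl', Function.update_of_ne hl]
    have ht : InTriple u i i' k w := by
      rcases hbw with h | h
      · left
        funext l
        by_cases hl : l = i
        · subst hl
          rw [Function.update_self, hui, haw]
        · rw [Function.update_of_ne hl]
          by_cases hl' : l = i'
          · subst hl'
            rw [hui', h]
          · rw [hu, Function.update_of_ne hl', Function.update_of_ne hl]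
      · right; right
        funext l
        by_cases hl' : l = i'
        · subst hl'
          rw [Function.update_self, hui', h]
        · rw [Function.update_of_ne hl']
          by_cases hl : l = i
          · subst hl
            rw [Function.update_self, hui, haw]
          · rw [Function.update_of_ne hl, hu, Function.update_of_ne hl', Function.update_of_ne hl]
    have ht₁ : InTriple u i i' k w₁ := Or.inr (Or.inl rfl)
    have hk' : k + 1 < e i' := by rwa [hi']
    have hp : factorProd n e w₁ = factorProd n e w := by
      rw [factorProd_inTriple hi' hk' (by rwa [hui]) (by rwa [hui']) (by rw [hui]; exact ⟨_, hfa⟩)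
        (by rw [hui']; exact ⟨_, hb⟩) ht,
        factorProd_inTriple hi' hk' (by rwa [hui]) (by rwa [hui']) (by rw [hui]; exact ⟨_, hfa⟩)
        (by rw [hui']; exact ⟨_, hb⟩) ht₁]
    have hr₁ : InRange n e w₁ := by
      intro l
      by_cases hl : l = i
      · subst hl
        rw [hw₁i]
        exact hfa
      · by_cases hl' : l = i'
        · subst hl'
          rw [hw₁i']
          exact (FixesOutside.simpleSwap (by omega) (by omega)).mul hb
        · rw [hw₁l l hl hl']
          exact hr l
    have hsum : ∑ j : Fin n, (n - j) * wordLength (w₁ j) < s := by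
      rw [← hs]
      have m1 : i ∈ Finset.univ := Finset.mem_univ i
      have m2 : i' ∈ Finset.univ.erase i := by simp [hne.symm]
      rw [← Finset.add_sum_erase _ _ m1, ← Finset.add_sum_erase _ _ m1,
        ← Finset.add_sum_erase _ _ m2, ← Finset.add_sum_erase _ _ m2, hw₁i, hw₁i']
      have h3 : ∑ j ∈ (Finset.univ.erase i).erase i', (n - j) * wordLength (w₁ j) =
          ∑ j ∈ (Finset.univ.erase i).erase i', (n - j) * wordLength (w j) := by
        apply Finset.sum_congr rfl
        intro l hl
        simp only [Finset.mem_erase] at hl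
        rw [hw₁l l hl.2.1 hl.1]
      rw [h3]
      have h4 := wordLength_mul_simpleSwap_lt (hr.finSupp i) hd
      have h5 : (n - i) * (wordLength a + 1) ≤ (n - i) * wordLength (w i) :=
        Nat.mul_le_mul_left _ h4
      rw [Nat.mul_add, mul_one] at h5
      omega
    obtain ⟨w', hm, hr', hn', hp'⟩ := ih _ hsum hr₁ (by rwa [hp]) rfl
    refine ⟨w', Relation.ReflTransGen.head ?_ hm, hr', hn', hp'.trans hp⟩
    -- Both ends of the move are lace diagrams because their common product is monotone on blocks.
    exact ⟨isLaceDiagram_of_blockMono hr hz, isLaceDiagram_of_blockMono hr₁ (by rwa [hp]), i, i', k,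
      u, hi', hk', by rwa [hui], by rwa [hui'], ht, ht₁⟩
  have hnk : (w i')⁻¹ k ≠ (w i')⁻¹ (k + 1) := fun h => by
    have := (w i')⁻¹.injective h
    omega
  by_cases hc : (w i')⁻¹ k < (w i')⁻¹ (k + 1)
  · refine main (w i') (hr i') hc (Or.inl rfl) ?_
    have h1 := Nat.mul_le_mul_left (n - i') (wordLength_simpleSwap_mul_le (hr.finSupp i') k)
    rw [Nat.mul_add, mul_one] at h1
    have := i.isLt
    omega
  · refine main (simpleSwap k * w i') ?_ ?_ (Or.inr ?_) ?_
    · exact (FixesOutside.simpleSwap (by omega) (by rw [hi']; omega)).mul (hr i')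
    · simp only [mul_inv_rev, simpleSwap_inv, Perm.mul_apply, simpleSwap_left, simpleSwap_right]
      omega
    · rw [← mul_assoc, simpleSwap_mul_self, one_mul]
    · rw [← mul_assoc, simpleSwap_mul_self, one_mul]
      have := i.isLt
      omega


/-! ### The product of a normal lace diagram -/

/-- The product of a normal lace diagram is increasing on the blocks of positions. -/
theorem IsNormal.factorProd_lt {n : ℕ} {e : ℕ → ℕ} {w : Fin n → Perm ℕ}
    (hl : IsLaceDiagram n e w) (hw : IsNormal n e w) {j k k' : ℕ} (hj : j ≤ n) (hk : k < k')
    (hk' : k' < e j) :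
    Hecke.perm (factorProd n e w) (∑ i ∈ Finset.Ioc j n, e i + k) <
      Hecke.perm (factorProd n e w) (∑ i ∈ Finset.Ioc j n, e i + k') := by
  induction n generalizing e j with
  | zero =>
    change ∑ i ∈ Finset.Ioc j 0, e i + k < ∑ i ∈ Finset.Ioc j 0, e i + k'
    omega
  | succ n ih =>
    have hr := hl.inRange
    have hl' : IsLaceDiagram n (shift e) fun j => w j.succ := fun j => hl j.succ
    have hQ := fixesOutside_factorProd hr.tail
    rw [hw.perm_factorProd_succ hr, Perm.mul_apply, Perm.mul_apply]
    rcases j with _ | j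
    · rw [sum_Ioc_zero, hQ _ (by omega), hQ _ (by omega), head_apply_last (hr 0) (by omega),
        head_apply_last (hr 0) hk']
      exact (hl 0).lt (by simp) (by omega)
    · have hM : ∑ i ∈ Finset.Ioc j n, shift e i + k' < totalDim n (shift e) := by
        have h1 : ∑ i ∈ Finset.Ioc j n, shift e i + shift e j ≤ totalDim n (shift e) := by
          rw [add_comm, Finset.add_sum_Ioc_eq_sum_Icc (by omega)]
          apply Finset.sum_le_sum_of_subset
          intro x hx
          simp at hx ⊢
          omega
        simp only [shift] at h1 ⊢
        omega
      rw [sum_Ioc_shift]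
      exact head_lt_head (hr 0) (hw 0) (ih hl' hw.tail (by omega) hk')
        (hQ.apply_mem ⟨Nat.zero_le _, hM⟩).2

/-- If the factors of a normal lace diagram preserve labels of the wires, then so does the product:
`δ j` are the labels of the dots of column `j`, `E j` those of the wires that enter at column `j`,
and `lab j` is the common label of the wires that leave at column `j`. -/
theorem IsNormal.factorProd_label {n : ℕ} {e : ℕ → ℕ} {w : Fin n → Perm ℕ}
    (hr : InRange n e w) (hw : IsNormal n e w) {δ E : ℕ → ℕ → ℕ} {lab : ℕ → ℕ}
    (h1 : ∀ j : Fin n, ∀ y, y < e (j + 1) → w j y < e j → δ j (w j y) = δ (j + 1) y)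
    (h2 : ∀ j : Fin n, ∀ y, y < e (j + 1) → e j ≤ w j y → E (j + 1) (w j y - e j) = δ (j + 1) y)
    (h3 : ∀ j : Fin n, ∀ y, y < e j → w j (e (j + 1) + y) < e j →
      δ j (w j (e (j + 1) + y)) = lab j)
    (h4 : ∀ j : Fin n, ∀ y, y < e j → e j ≤ w j (e (j + 1) + y) →
      E (j + 1) (w j (e (j + 1) + y) - e j) = lab j)
    (h5 : ∀ y, y < e n → δ n y = lab n) {j k y : ℕ} (hj : j ≤ n) (hk : k < e j)
    (hy : Hecke.perm (factorProd n e w) (∑ i ∈ Finset.Ioc j n, e i + k) = y) :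
    (y < e 0 → δ 0 y = lab j) ∧
      ∀ i, i < n → ∑ l ∈ Finset.range (i + 1), e l ≤ y → y < ∑ l ∈ Finset.range (i + 2), e l →
        E (i + 1) (y - ∑ l ∈ Finset.range (i + 1), e l) = lab j := by
  induction n generalizing e j y δ E lab with
  | zero =>
    obtain rfl : j = 0 := by omega
    have hy : k = y := by simpa [factorProd, hProd] using hy
    subst hy
    exact ⟨h5 k, fun i hi => absurd hi (Nat.not_lt_zero i)⟩
  | succ n ih =>
    have hQ := fixesOutside_factorProd hr.tail
    have hsum : ∀ i, ∑ l ∈ Finset.range (i + 1), e l = ∑ l ∈ Finset.range i, shift e l + e 0 :=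
      fun i => Finset.sum_range_succ' _ _
    have hsum1 : ∀ i, e 1 ≤ ∑ l ∈ Finset.range (i + 1), shift e l := fun i =>
      le_totalDim i (shift e)
    -- wires that meet only the first factor
    have hfirst : ∀ x c, x < e 0 + e 1 → (x < e 0 → δ 0 x = c) → (e 0 ≤ x → E 1 (x - e 0) = c) →
        (x < e 0 → δ 0 x = c) ∧ ∀ i, i < n + 1 → ∑ l ∈ Finset.range (i + 1), e l ≤ x →
          x < ∑ l ∈ Finset.range (i + 2), e l →
          E (i + 1) (x - ∑ l ∈ Finset.range (i + 1), e l) = c := by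
      intro x c hx hx1 hx2
      refine ⟨hx1, fun i _ hi1 hi2 => ?_⟩
      rcases i with _ | i
      · simp only [zero_add, Finset.sum_range_one] at hi1 ⊢
        exact hx2 hi1
      · have := hsum (i + 1)
        have := hsum1 i
        omega
    have hr0 := hr 0
    simp only [Fin.val_zero, zero_add] at hr0
    rw [hw.perm_factorProd_succ hr, Perm.mul_apply] at hy
    -- The wires that leave at column `0` are fixed by the tail and meet only the first factor.
    rcases j with _ | j
    · rw [sum_Ioc_zero, hQ _ (by omega), head_apply_last hr0 hk] at hy
      rw [← hy]
      refine hfirst _ _ (hr0.apply_mem ⟨Nat.zero_le _, by omega⟩).2 (h3 0 k hk) (h4 0 k hk)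
    · rw [sum_Ioc_shift] at hy
      set y' := Hecke.perm (factorProd n (shift e) fun j => w j.succ)
        (∑ i ∈ Finset.Ioc j n, shift e i + k) with hy'
      obtain ⟨a1, a2⟩ := ih (e := shift e) (δ := fun i => δ (i + 1)) (E := fun i => E (i + 1))
        (lab := fun i => lab (i + 1)) hr.tail hw.tail (fun j => h1 j.succ) (fun j => h2 j.succ)
        (fun j => h3 j.succ) (fun j => h4 j.succ) h5 (by omega) hk hy'.symm
      simp only [zero_add] at a1
      have hM : y' < totalDim n (shift e) := by
        refine (hQ.apply_mem ⟨Nat.zero_le _, ?_⟩).2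
        have h1 : ∑ i ∈ Finset.Ioc j n, shift e i + shift e j ≤ totalDim n (shift e) := by
          rw [add_comm, Finset.add_sum_Ioc_eq_sum_Icc (by omega)]
          apply Finset.sum_le_sum_of_subset
          intro x hx
          simp at hx ⊢
          omega
        simp only [shift] at h1 hk ⊢
        omega
      -- A wire that the tail brings to a dot of column `1` continues into `w 0`; any other is
      -- merely shifted by `e 0`.
      by_cases hlt : y' < e 1
      · rw [head_apply_of_lt hr0 hlt] at hy
        rw [← hy]
        refine hfirst _ _ (hr0.apply_mem ⟨Nat.zero_le _, by omega⟩).2 (fun h => ?_) fun h => ?_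
        · exact (h1 0 y' hlt h).trans (a1 hlt)
        · exact (h2 0 y' hlt h).trans (a1 hlt)
      · rw [head_apply_of_le hr0 (not_lt.1 hlt) hM] at hy
        refine ⟨fun h => by omega, fun i hi hi1 hi2 => ?_⟩
        rw [hsum] at hi1 hi2
        rw [hsum, ← hy, Nat.add_sub_add_right]
        rcases i with _ | i
        · simp only [zero_add, Finset.sum_range_one, shift] at hi2
          omega
        · exact a2 i (by omega) (by omega) (by rw [show i + 2 = i + 1 + 1 from rfl]; omega)

/-! ### Zelevinsky permutations -/

theorem sum_blocks {n j : ℕ} (e : ℕ → ℕ) (hj : j ≤ n) :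
    ∑ k ∈ Finset.range j, e k + e j + ∑ k ∈ Finset.Ioc j n, e k = totalDim n e := by
  rw [← Finset.sum_range_succ, totalDim, ← Finset.Ico_succ_succ_eq_Ioc]
  exact Finset.sum_range_add_sum_Ico e (Nat.succ_le_succ hj)

theorem sum_Ioc_eq_add {i n : ℕ} (e : ℕ → ℕ) (hi : i + 1 ≤ n) :
    ∑ k ∈ Finset.Ioc i n, e k = ∑ k ∈ Finset.Ioc (i + 1) n, e k + e (i + 1) := by
  rw [add_comm, Finset.add_sum_Ioc_eq_sum_Icc hi]
  congr 1
  ext x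
  simp only [Finset.mem_Ioc, Finset.mem_Icc]
  omega

theorem inBlockRow_iff {e : ℕ → ℕ} {j p : ℕ} : InBlockRow e j p ↔
    ∑ k ∈ Finset.range j, e k ≤ p ∧ p < ∑ k ∈ Finset.range j, e k + e j := by
  rw [InBlockRow, Finset.sum_range_succ]

theorem inBlockCol_iff {n : ℕ} {e : ℕ → ℕ} {i q : ℕ} (hi : i ≤ n) : InBlockCol n e i q ↔
    ∑ k ∈ Finset.Ioc i n, e k ≤ q ∧ q < ∑ k ∈ Finset.Ioc i n, e k + e i := by
  rw [InBlockCol, ← Finset.add_sum_Ioc_eq_sum_Icc hi, add_comm (e i)]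

theorem exists_block {e : ℕ → ℕ} {n x : ℕ} (hx : x < totalDim n e) :
    ∃ i, i ≤ n ∧ ∑ k ∈ Finset.range i, e k ≤ x ∧ x < ∑ k ∈ Finset.range i, e k + e i := by
  induction n with
  | zero => exact ⟨0, le_rfl, by simp, by simpa [totalDim] using hx⟩
  | succ n ih =>
    by_cases h : x < totalDim n e
    · obtain ⟨i, hi, h1⟩ := ih h
      exact ⟨i, by omega, h1⟩
    · refine ⟨n + 1, le_rfl, not_lt.1 h, ?_⟩
      rwa [← Finset.sum_range_succ]

theorem eq_of_lt_iff {N : ℕ} {v v' : Perm (Fin N)} (h : ∀ p p', v p < v p' → v' p < v' p') :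
    v = v' := by
  have hm : StrictMono (v' * v⁻¹ : Perm (Fin N)) := by
    intro x y hxy
    rw [Perm.mul_apply, Perm.mul_apply]
    apply h
    change v (v.symm x) < v (v.symm y)
    rwa [Equiv.apply_symm_apply, Equiv.apply_symm_apply]
  have hid : hm.orderIsoOfSurjective _ (v' * v⁻¹).surjective = OrderIso.refl (Fin N) :=
    Subsingleton.elim _ _
  have h1 : v' * v⁻¹ = 1 := by
    apply Equiv.ext
    intro k
    exact congrArg (fun f : Fin N ≃o Fin N => f k) hid
  rw [mul_inv_eq_one] at h1
  exact h1.symm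

/-- The permutation with the block counts and the monotonicity of a Zelevinsky permutation is
unique. -/
theorem IsZelevinsky.unique {n : ℕ} {e : ℕ → ℕ} {r : ℕ → ℕ → ℕ}
    {v v' : Perm (Fin (totalDim n e))} (hv : IsZelevinsky n e r v) (hv' : IsZelevinsky n e r v') :
    v = v' := by
  classical
  -- both permutations have the same entries in the block columns from `i` on
  have key : ∀ d i, i + d = n → ∀ p, (v p : ℕ) < ∑ k ∈ Finset.Ioc i n, e k ↔
      (v' p : ℕ) < ∑ k ∈ Finset.Ioc i n, e k := by
    intro d
    induction d with
    | zero =>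
      intro i hi p
      obtain rfl : i = n := by omega
      simp
    | succ d ih =>
      intro i hi p
      obtain ⟨j, hj, hpj⟩ := exists_block p.isLt
      rw [← inBlockRow_iff] at hpj
      have hcol : ∑ k ∈ Finset.Ioc i n, e k = ∑ k ∈ Finset.Ioc (i + 1) n, e k + e (i + 1) :=
        sum_Ioc_eq_add e (by omega)
      have hcard : ∀ u : Perm (Fin (totalDim n e)),
          (Finset.univ.filter fun p : Fin (totalDim n e) => InBlockRow e j p ∧
            (u p : ℕ) < ∑ k ∈ Finset.Ioc i n, e k).card
          = (Finset.univ.filter fun p : Fin (totalDim n e) => InBlockRow e j p ∧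
              (u p : ℕ) < ∑ k ∈ Finset.Ioc (i + 1) n, e k).card +
            (Finset.univ.filter fun p : Fin (totalDim n e) => InBlockRow e j p ∧
              InBlockCol n e (i + 1) (u p)).card := by
        intro u
        rw [← Finset.card_union_of_disjoint]
        · congr 1
          ext x
          simp only [Finset.mem_filter, Finset.mem_univ, true_and, Finset.mem_union,
            inBlockCol_iff (show i + 1 ≤ n by omega), hcol, ← and_or_left]
          apply and_congr_right
          intro _
          omega
        · rw [Finset.disjoint_filter]
          intro x _ h1 h2
          rw [inBlockCol_iff (show i + 1 ≤ n by omega)] at h2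
          omega
      have heq : (Finset.univ.filter fun p : Fin (totalDim n e) => InBlockRow e j p ∧
            (v p : ℕ) < ∑ k ∈ Finset.Ioc i n, e k).card =
          (Finset.univ.filter fun p : Fin (totalDim n e) => InBlockRow e j p ∧
            (v' p : ℕ) < ∑ k ∈ Finset.Ioc i n, e k).card := by
        rw [hcard v, hcard v']
        congr 1
        · congr 1
          apply Finset.filter_congr
          intro x _
          rw [ih (i + 1) (by omega)]
        · have a1 := hv.1 j (i + 1) hj (by omega)
          have a2 := hv'.1 j (i + 1) hj (by omega)
          rw [← a2] at a1
          convert a1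
      have hinit : ∀ u u' : Perm (Fin (totalDim n e)),
          (∀ p p' : Fin (totalDim n e), InBlockRow e j p → InBlockRow e j p' → p < p' →
            u' p < u' p') →
          ∀ p p' : Fin (totalDim n e), p' ≤ p → InBlockRow e j p → InBlockRow e j p' →
            (u' p : ℕ) < ∑ k ∈ Finset.Ioc i n, e k → (u' p' : ℕ) < ∑ k ∈ Finset.Ioc i n, e k := by
        intro u u' hu p p' hle hp hp' hlt
        rcases hle.eq_or_lt with rfl | hle
        · exact hlt
        · exact lt_trans (Fin.lt_def.1 (hu p' p hp' hp hle)) hlt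
      have hmv := hinit v v (hv.2.1 j hj)
      have hmv' := hinit v' v' (hv'.2.1 j hj)
      -- In a block row, the entries left of a column border form an initial segment. Two initial
      -- segments are nested, so equal size makes them equal.
      have hset : (Finset.univ.filter fun p : Fin (totalDim n e) => InBlockRow e j p ∧
            (v p : ℕ) < ∑ k ∈ Finset.Ioc i n, e k) =
          (Finset.univ.filter fun p : Fin (totalDim n e) => InBlockRow e j p ∧
            (v' p : ℕ) < ∑ k ∈ Finset.Ioc i n, e k) := by
        by_cases hsub : (Finset.univ.filter fun p : Fin (totalDim n e) => InBlockRow e j p ∧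
            (v p : ℕ) < ∑ k ∈ Finset.Ioc i n, e k) ⊆
          (Finset.univ.filter fun p : Fin (totalDim n e) => InBlockRow e j p ∧
            (v' p : ℕ) < ∑ k ∈ Finset.Ioc i n, e k)
        · exact Finset.eq_of_subset_of_card_le hsub heq.ge
        · symm
          refine Finset.eq_of_subset_of_card_le (fun x hx => ?_) heq.le
          obtain ⟨y, hy, hy'⟩ := Finset.not_subset.1 hsub
          simp only [Finset.mem_filter, Finset.mem_univ, true_and] at hx hy hy' ⊢
          refine ⟨hx.1, ?_⟩
          rcases le_total x y with hxy | hxy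
          · exact hmv y x hxy hy.1 hx.1 hy.2
          · exact absurd ⟨hy.1, hmv' x y hxy hx.1 hy.1 hx.2⟩ hy'
      have := Finset.ext_iff.1 hset p
      simpa [hpj] using this
  have key0 : ∀ i, i ≤ n → ∀ p, InBlockCol n e i (v p) ↔ InBlockCol n e i (v' p) := by
    intro i hi p
    have h1 := key (n - i) i (by omega) p
    rw [inBlockCol_iff hi, inBlockCol_iff hi]
    rcases i with _ | i
    · have := sum_blocks e hi
      have := (v p).isLt
      have := (v' p).isLt
      simp only [Finset.range_zero, Finset.sum_empty] at *
      omega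
    · have h2 := key (n - i) i (by omega) p
      have hcol : ∑ k ∈ Finset.Ioc i n, e k = ∑ k ∈ Finset.Ioc (i + 1) n, e k + e (i + 1) :=
        sum_Ioc_eq_add e (by omega)
      omega
  apply eq_of_lt_iff
  intro p p' hlt
  have hN := (v p).isLt
  -- Block columns are numbered from right to left, hence the reflected value. Two entries are
  -- compared by their block columns, and inside one block column by their rows.
  obtain ⟨i, hi, hpi⟩ := exists_block (e := e) (n := n) (x := totalDim n e - 1 - v p) (by omega)
  have hs := sum_blocks e hi
  have hcol : InBlockCol n e i (v p) := by
    rw [inBlockCol_iff hi]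
    omega
  have hcol1 := (key0 i hi p).1 hcol
  rw [Fin.lt_def] at hlt ⊢
  by_cases hc : InBlockCol n e i (v p')
  · have hpp : p < p' := by
      by_contra hpp
      rcases (not_lt.1 hpp).eq_or_lt with rfl | hpp
      · omega
      · have := Fin.lt_def.1 (hv.2.2 i hi p' p hc hcol hpp)
        omega
    exact Fin.lt_def.1 (hv'.2.2 i hi p p' hcol1 ((key0 i hi p').1 hc) hpp)
  · have h1 := key (n - i) i (by omega) p'
    have hc1 := mt (key0 i hi p').2 hc
    rw [inBlockCol_iff hi] at hc hcol hcol1 hc1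
    omega

/-- Reversing both rows and columns keeps the north-west to south-east order. Block row `j` becomes
the positions following the blocks `n, …, j + 1`, and block column `i` the values following the
blocks `0, …, i - 1`. -/
theorem IsZelevinsky.blockMono {n : ℕ} {e : ℕ → ℕ} {r : ℕ → ℕ → ℕ}
    {v : Perm (Fin (totalDim n e))} (hv : IsZelevinsky n e r v) {z : Perm ℕ}
    (hz : ∀ p : Fin (totalDim n e), z (Fin.rev p : Fin (totalDim n e)) = (Fin.rev (v p) : ℕ)) :
    BlockMono n e z := by
  constructor
  · intro j hj k hk
    have hs := sum_blocks e hj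
    obtain ⟨p, hp⟩ : ∃ p : Fin (totalDim n e),
        (p : ℕ) = totalDim n e - (∑ i ∈ Finset.Ioc j n, e i + k + 1) := ⟨⟨_, by omega⟩, rfl⟩
    obtain ⟨p', hp'⟩ : ∃ p : Fin (totalDim n e),
        (p : ℕ) = totalDim n e - (∑ i ∈ Finset.Ioc j n, e i + k + 1 + 1) := ⟨⟨_, by omega⟩, rfl⟩
    have h1 := hz p
    have h2 := hz p'
    rw [Fin.val_rev, Fin.val_rev, hp] at h1
    rw [Fin.val_rev, Fin.val_rev, hp'] at h2
    rw [show ∑ i ∈ Finset.Ioc j n, e i + k = totalDim n e -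
      (totalDim n e - (∑ i ∈ Finset.Ioc j n, e i + k + 1) + 1) by omega, h1,
      show totalDim n e - (totalDim n e - (∑ i ∈ Finset.Ioc j n, e i + k + 1) + 1) + 1 =
        totalDim n e - (totalDim n e - (∑ i ∈ Finset.Ioc j n, e i + k + 1 + 1) + 1) by omega, h2]
    have h3 := Fin.lt_def.1 (hv.2.1 j hj p' p (by rw [inBlockRow_iff]; omega)
      (by rw [inBlockRow_iff]; omega) (by rw [Fin.lt_def]; omega))
    have := (v p).isLt
    omega
  · intro i hi k hk
    have hs := sum_blocks e hi
    have hex : ∀ x, x < totalDim n e → ∃ p : Fin (totalDim n e),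
        (v p : ℕ) = totalDim n e - (x + 1) ∧ z⁻¹ x = totalDim n e - (p + 1) := by
      intro x hx
      refine ⟨v.symm ⟨totalDim n e - (x + 1), by omega⟩, ?_⟩
      have h1 := hz (v.symm ⟨totalDim n e - (x + 1), by omega⟩)
      rw [Equiv.apply_symm_apply, Fin.val_rev, Fin.val_rev] at h1
      refine ⟨by rw [Equiv.apply_symm_apply], ?_⟩
      rw [Perm.inv_eq_iff_eq, h1]
      simp only
      omega
    obtain ⟨p, hp, hp'⟩ := hex (∑ l ∈ Finset.range i, e l + k) (by omega)
    obtain ⟨q, hq, hq'⟩ := hex (∑ l ∈ Finset.range i, e l + k + 1) (by omega)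
    rw [hp', hq']
    have hqp : q < p := by
      by_contra hc
      rcases (not_lt.1 hc).eq_or_lt with h | h
      · rw [h] at hp
        omega
      · have := Fin.lt_def.1 (hv.2.2 i hi p q (by rw [inBlockCol_iff hi]; omega)
          (by rw [inBlockCol_iff hi]; omega) h)
        omega
    rw [Fin.lt_def] at hqp
    have := p.isLt
    omega

/-- The permutation with entries counted from the bottom right corner. -/
def revConj {N : ℕ} (z : Perm ℕ) (hz : FixesOutside 0 N z) : Perm (Fin N) where
  toFun p := ⟨N - 1 - z (N - 1 - p), by have := p.isLt; omega⟩
  invFun p := ⟨N - 1 - z⁻¹ (N - 1 - p), by have := p.isLt; omega⟩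
  left_inv p := by
    have h1 := (hz.apply_mem (k := N - 1 - p) (by omega)).2
    ext
    simp only
    rw [show N - 1 - (N - 1 - z (N - 1 - p)) = z (N - 1 - p) by omega, inv_apply_self']
    omega
  right_inv p := by
    have h1 := (hz.inv.apply_mem (k := N - 1 - p) (by omega)).2
    ext
    simp only
    rw [show N - 1 - (N - 1 - z⁻¹ (N - 1 - p)) = z⁻¹ (N - 1 - p) by omega, apply_inv_self']
    omega

/-- A permutation is the Zelevinsky permutation if the values are labelled, in weakly decreasing
order on each block and as often as prescribed, by the blocks of their positions. -/
theorem exists_isZelevinsky {n : ℕ} {e : ℕ → ℕ} {r : ℕ → ℕ → ℕ} {z : Perm ℕ}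
    (hz : FixesOutside 0 (totalDim n e) z) (F : ℕ → ℕ → ℕ)
    (hF : ∀ j i k t, j ≤ n → i ≤ n → k < e j → t < e i →
      z (∑ l ∈ Finset.Ioc j n, e l + k) = ∑ l ∈ Finset.range i, e l + t → F i t = j)
    (hmono : ∀ j k k', j ≤ n → k < k' → k' < e j →
      z (∑ l ∈ Finset.Ioc j n, e l + k) < z (∑ l ∈ Finset.Ioc j n, e l + k'))
    (hanti : ∀ i t t', i ≤ n → t < t' → t' < e i → F i t' ≤ F i t)
    (hcount : ∀ i j, i ≤ n → j ≤ n → ((Finset.range (e i)).filter fun t => F i t = j).card =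
      if i ≤ j then strandCount n r i j else if i = j + 1 then r j i else 0) :
    ∃ v : Perm (Fin (totalDim n e)), IsZelevinsky n e r v ∧
      ∀ p : Fin (totalDim n e), z (Fin.rev p : Fin (totalDim n e)) = (Fin.rev (v p) : ℕ) := by
  have hval : ∀ p : Fin (totalDim n e),
      (revConj z hz p : ℕ) = totalDim n e - 1 - z (totalDim n e - 1 - p) := fun _ => rfl
  have hlt : ∀ p : Fin (totalDim n e), z (totalDim n e - 1 - p) < totalDim n e := fun p =>
    (hz.apply_mem (k := totalDim n e - 1 - p) (by omega)).2
  -- positions and values of an entry in terms of its blocks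
  have hpos : ∀ j, j ≤ n → ∀ p : Fin (totalDim n e), InBlockRow e j p →
      ∃ k, k < e j ∧ totalDim n e - 1 - p = ∑ l ∈ Finset.Ioc j n, e l + k := by
    intro j hj p hp
    have hs := sum_blocks e hj
    rw [inBlockRow_iff] at hp
    exact ⟨totalDim n e - 1 - p - ∑ l ∈ Finset.Ioc j n, e l, by omega, by omega⟩
  have hcol : ∀ i, i ≤ n → ∀ p : Fin (totalDim n e), InBlockCol n e i (revConj z hz p) →
      ∃ t, t < e i ∧ z (totalDim n e - 1 - p) = ∑ l ∈ Finset.range i, e l + t := by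
    intro i hi p hp
    have hs := sum_blocks e hi
    have := hlt p
    rw [inBlockCol_iff hi, hval] at hp
    exact ⟨z (totalDim n e - 1 - p) - ∑ l ∈ Finset.range i, e l, by omega, by omega⟩
  have hrow : ∀ p : Fin (totalDim n e), ∃ j, j ≤ n ∧ InBlockRow e j p := by
    intro p
    obtain ⟨j, hj, hp⟩ := exists_block p.isLt
    exact ⟨j, hj, inBlockRow_iff.2 hp⟩
  refine ⟨revConj z hz, ⟨fun j i hj hi => ?_, fun j hj p p' hp hp' hpp => ?_,
    fun i hi p p' hp hp' hpp => ?_⟩, fun p => ?_⟩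
  · rw [← hcount i j hi hj]
    have hs := sum_blocks e hi
    apply Finset.card_bij (fun (p : Fin (totalDim n e)) _ =>
      z (totalDim n e - 1 - p) - ∑ l ∈ Finset.range i, e l)
    · intro p hp
      simp only [Finset.mem_filter, Finset.mem_univ, true_and] at hp
      obtain ⟨k, hk, hk'⟩ := hpos j hj p hp.1
      obtain ⟨t, ht, ht'⟩ := hcol i hi p hp.2
      rw [ht', Nat.add_sub_cancel_left]
      simp only [Finset.mem_filter, Finset.mem_range]
      exact ⟨ht, hF j i k t hj hi hk ht (by rw [← hk', ht'])⟩
    · intro p hp p' hp' h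
      simp only [Finset.mem_filter, Finset.mem_univ, true_and] at hp hp'
      obtain ⟨t, ht, ht'⟩ := hcol i hi p hp.2
      obtain ⟨t', ht1, ht1'⟩ := hcol i hi p' hp'.2
      rw [ht', ht1', Nat.add_sub_cancel_left, Nat.add_sub_cancel_left] at h
      rw [h, ← ht1'] at ht'
      have := z.injective ht'
      ext
      omega
    · intro t ht
      simp only [Finset.mem_filter, Finset.mem_range] at ht
      have hq := (hz.inv.apply_mem (k := ∑ l ∈ Finset.range i, e l + t) (by omega)).2
      obtain ⟨p, hp⟩ : ∃ p : Fin (totalDim n e),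
          (p : ℕ) = totalDim n e - 1 - z⁻¹ (∑ l ∈ Finset.range i, e l + t) := ⟨⟨_, by omega⟩, rfl⟩
      have hzp : z (totalDim n e - 1 - p) = ∑ l ∈ Finset.range i, e l + t := by
        rw [hp, show totalDim n e - 1 - (totalDim n e - 1 - z⁻¹ (∑ l ∈ Finset.range i, e l + t)) =
          z⁻¹ (∑ l ∈ Finset.range i, e l + t) by omega, apply_inv_self']
      refine ⟨p, ?_, by rw [hzp, Nat.add_sub_cancel_left]⟩
      simp only [Finset.mem_filter, Finset.mem_univ, true_and]
      obtain ⟨j', hj', hpj'⟩ := hrow p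
      obtain ⟨k, hk, hk'⟩ := hpos j' hj' p hpj'
      have := hF j' i k t hj' hi hk ht.1 (by rw [← hk', hzp])
      rw [ht.2] at this
      subst this
      refine ⟨hpj', ?_⟩
      rw [inBlockCol_iff hi, hval, hzp]
      omega
  · obtain ⟨k, hk, hk'⟩ := hpos j hj p hp
    obtain ⟨l, hl, hl'⟩ := hpos j hj p' hp'
    rw [Fin.lt_def] at hpp ⊢
    rw [hval, hval, hk', hl']
    have h1 := hmono j l k hj (by omega) hk
    have h2 := hlt p
    rw [hk'] at h2
    omega
  · obtain ⟨t, ht, ht'⟩ := hcol i hi p hp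
    obtain ⟨t', ht1, ht1'⟩ := hcol i hi p' hp'
    obtain ⟨j, hj, hpj⟩ := hrow p
    obtain ⟨j', hj', hpj'⟩ := hrow p'
    obtain ⟨k, hk, hk'⟩ := hpos j hj p hpj
    obtain ⟨l, hl, hl'⟩ := hpos j' hj' p' hpj'
    have f1 := hF j i k t hj hi hk ht (by rw [← hk', ht'])
    have f2 := hF j' i l t' hj' hi hl ht1 (by rw [← hl', ht1'])
    have h2 := hlt p
    rw [Fin.lt_def] at hpp ⊢
    have hjj : j ≤ j' := by
      by_contra hc
      have := Finset.sum_le_sum_of_subset (f := e)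
        (Finset.range_subset_range.2 (show j' + 1 ≤ j by omega))
      rw [Finset.sum_range_succ] at this
      rw [inBlockRow_iff] at hpj hpj'
      omega
    -- In one block row the order of the positions decides; in different ones the labels differ and
    -- decrease along the block of values.
    have htt : t' < t := by
      rcases hjj.eq_or_lt with rfl | hjj
      · have h1 := hmono j l k hj (by omega) hk
        rw [← hk', ← hl', ht', ht1'] at h1
        omega
      · by_contra hc
        rcases (not_lt.1 hc).eq_or_lt with rfl | hc
        · omega
        · have := hanti i t t' hi hc ht1
          omega
    rw [hval, hval, ht', ht1']
    omega
  · rw [Fin.val_rev, Fin.val_rev, hval]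
    have h1 := hlt p
    rw [show totalDim n e - (p + 1) = totalDim n e - 1 - p by omega]
    omega


/-! ### Rank conditions of orbits -/

/-- The image in the `j`-th vector space of the `i`-th one. -/
noncomputable def imageAt {e : ℕ → ℕ} (φ : QuiverRep e) (i : ℕ) :
    ∀ j : ℕ, Submodule ℂ (Fin (e j) → ℂ)
  | 0 => if i = 0 then ⊤ else ⊥
  | j + 1 => if i = j + 1 then ⊤ else (imageAt φ i j).map (φ j)

theorem imageAt_self {e : ℕ → ℕ} (φ : QuiverRep e) (i : ℕ) : imageAt φ i i = ⊤ := by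
  cases i <;> simp [imageAt]

theorem imageAt_succ {e : ℕ → ℕ} (φ : QuiverRep e) {i j : ℕ} (h : i ≤ j) :
    imageAt φ i (j + 1) = (imageAt φ i j).map (φ j) := by
  rw [imageAt, if_neg (by omega)]

theorem imageAt_add {e : ℕ → ℕ} (φ : QuiverRep e) (i k : ℕ) :
    imageAt φ i (i + k) = LinearMap.range (φ.comp i k) := by
  induction k with
  | zero => rw [QuiverRep.comp, LinearMap.range_id]; exact imageAt_self φ i
  | succ k ih =>
    rw [QuiverRep.comp, LinearMap.range_comp, ← ih]
    exact imageAt_succ φ (Nat.le_add_right i k)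

theorem imageAt_le {e : ℕ → ℕ} (φ : QuiverRep e) {i j : ℕ} (h : i + 1 ≤ j) :
    imageAt φ i j ≤ imageAt φ (i + 1) j := by
  induction j, h using Nat.le_induction with
  | base => rw [imageAt_self]; exact le_top
  | succ j hj ih =>
    rw [imageAt_succ φ (by omega), imageAt_succ φ hj]
    exact Submodule.map_mono ih

/-- The dimension lost under `f` is that of the intersection with the kernel, which grows with the
subspace. Applied to images of successive vertices, this makes the strand counts non-negative. -/
theorem finrank_map_add_finrank_le {V W : Type*} [AddCommGroup V] [Module ℂ V] [AddCommGroup W]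
    [Module ℂ W] [FiniteDimensional ℂ V] (f : V →ₗ[ℂ] W) {A B : Submodule ℂ V} (h : A ≤ B) :
    Module.finrank ℂ A + Module.finrank ℂ (B.map f) ≤
      Module.finrank ℂ B + Module.finrank ℂ (A.map f) := by
  have key : ∀ C : Submodule ℂ V, Module.finrank ℂ (C.map f) +
      Module.finrank ℂ (C ⊓ LinearMap.ker f : Submodule ℂ V) = Module.finrank ℂ C := by
    intro C
    have h1 := LinearMap.finrank_range_add_finrank_ker (f.domRestrict C)
    rw [LinearMap.range_domRestrict, LinearMap.ker_domRestrict] at h1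
    rw [← h1]
    congr 1
    rw [← Submodule.finrank_map_subtype_eq C, Submodule.map_comap_subtype]
  have h1 := key A
  have h2 := key B
  have h3 : Module.finrank ℂ (A ⊓ LinearMap.ker f : Submodule ℂ V) ≤
      Module.finrank ℂ (B ⊓ LinearMap.ker f : Submodule ℂ V) :=
    Submodule.finrank_mono (inf_le_inf_right _ h)
  omega

theorem IsOrbit.exists_eq {n : ℕ} {e : ℕ → ℕ} {r : ℕ → ℕ → ℕ} (hr : IsOrbit n e r) :
    ∃ φ : QuiverRep e, ∀ i j, i ≤ j → j ≤ n → r i j = Module.finrank ℂ (imageAt φ i j) := by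
  obtain ⟨φ, hφ⟩ := hr
  refine ⟨φ, fun i j hij hj => ?_⟩
  rw [hφ i j hij hj]
  obtain ⟨k, rfl⟩ := Nat.exists_eq_add_of_le hij
  rw [imageAt_add, Nat.add_sub_cancel_left]

theorem IsOrbit.self_eq {n : ℕ} {e : ℕ → ℕ} {r : ℕ → ℕ → ℕ} (hr : IsOrbit n e r) {i : ℕ}
    (hi : i ≤ n) : r i i = e i := by
  obtain ⟨φ, hφ⟩ := hr.exists_eq
  rw [hφ i i le_rfl hi, imageAt_self, finrank_top, Module.finrank_fin_fun]

/-- The strand counts of an orbit are differences of non-negative numbers. -/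
theorem IsOrbit.strandCount_add {n : ℕ} {e : ℕ → ℕ} {r : ℕ → ℕ → ℕ} (hr : IsOrbit n e r)
    {i j : ℕ} (hij : i ≤ j) (hj : j ≤ n) :
    strandCount n r i j + (rkPred n r i j + rk n r i (j + 1)) =
      rk n r i j + rkPred n r i (j + 1) := by
  obtain ⟨φ, hφ⟩ := hr.exists_eq
  apply Nat.sub_add_cancel
  have hmap : ∀ i, i ≤ j → j + 1 ≤ n → r i (j + 1) ≤ r i j := by
    intro i hi hjn
    rw [hφ i j hi hj, hφ i (j + 1) (by omega) hjn, imageAt_succ φ hi]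
    exact Submodule.finrank_map_le _ _
  rcases i with _ | i
  · simp only [rkPred, rk, if_pos hj, zero_add, add_zero]
    split_ifs with h
    · exact hmap 0 hij h
    · exact Nat.zero_le _
  · simp only [rkPred, rk, if_pos hj]
    split_ifs with h
    · rw [hφ i j (by omega) hj, hφ (i + 1) j hij hj, hφ i (j + 1) (by omega) h,
        hφ (i + 1) (j + 1) (by omega) h, imageAt_succ φ (by omega : i ≤ j), imageAt_succ φ hij]
      exact finrank_map_add_finrank_le _ (imageAt_le φ hij)
    · rw [hφ i j (by omega) hj, hφ (i + 1) j hij hj, add_zero, add_zero]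
      exact Submodule.finrank_mono (imageAt_le φ hij)

/-- The double difference defining the strand counts telescopes, over the starting column and then
over the final one. -/
theorem IsOrbit.sum_strandCount {n : ℕ} {e : ℕ → ℕ} {r : ℕ → ℕ → ℕ} (hr : IsOrbit n e r)
    {a b : ℕ} (hab : a ≤ b) (hb : b ≤ n) :
    ∑ i ∈ Finset.range (a + 1), ∑ j ∈ Finset.Ico b (n + 1), strandCount n r i j = r a b := by
  have h1 : ∀ j, b ≤ j → j ≤ n → ∀ a', a' ≤ a →
      ∑ i ∈ Finset.range (a' + 1), strandCount n r i j + rk n r a' (j + 1) = rk n r a' j := by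
    intro j hj hjn a'
    induction a' with
    | zero =>
      intro _
      have := hr.strandCount_add (Nat.zero_le j) hjn
      simpa [rkPred] using this
    | succ a' ih =>
      intro ha'
      have h2 := hr.strandCount_add (i := a' + 1) (j := j) (by omega) hjn
      have h3 := ih (by omega)
      simp only [rkPred] at h2
      rw [Finset.sum_range_succ]
      omega
  have h2 : ∀ m, b ≤ m → m ≤ n + 1 →
      ∑ j ∈ Finset.Ico b m, ∑ i ∈ Finset.range (a + 1), strandCount n r i j + rk n r a m =
        rk n r a b := by
    intro m hm
    induction m, hm using Nat.le_induction with
    | base => simp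
    | succ m hm ih =>
      intro hmn
      have h3 := ih (by omega)
      have h4 := h1 m hm (by omega) a le_rfl
      rw [Finset.sum_Ico_succ_top hm]
      omega
  have h3 := h2 (n + 1) (by omega) le_rfl
  rw [Finset.sum_comm]
  simpa [rk, hb] using h3

/-! ### The strands of the left-most lace diagram -/

theorem countP_strandList (n : ℕ) (r : ℕ → ℕ → ℕ) (p : ℕ × ℕ → Bool) :
    (strandList n r).countP p = ∑ i ∈ Finset.range (n + 1), ∑ j ∈ Finset.Ico i (n + 1),
      if p (i, j) then strandCount n r i j else 0 := by
  rw [strandList, List.countP_flatMap]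
  change ∑ i ∈ Finset.range (n + 1), _ = _
  apply Finset.sum_congr rfl
  intro i _
  rw [Function.comp_apply, List.countP_flatMap, List.map_reverse, List.sum_reverse]
  change ∑ j ∈ Finset.Ico i (n + 1), _ = _
  apply Finset.sum_congr rfl
  intro j _
  rw [Function.comp_apply, List.countP_replicate]

theorem IsOrbit.countP_strandList {n : ℕ} {e : ℕ → ℕ} {r : ℕ → ℕ → ℕ} (hr : IsOrbit n e r)
    {a b : ℕ} (hab : a ≤ b) (hb : b ≤ n) :
    (strandList n r).countP (fun s => decide (s.1 ≤ a ∧ b ≤ s.2)) = r a b := by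
  rw [KMS.countP_strandList, ← hr.sum_strandCount hab hb]
  symm
  apply Finset.sum_subset_zero_on_sdiff
  · exact Finset.range_subset_range.2 (by omega)
  · intro i hi
    simp only [Finset.mem_sdiff, Finset.mem_range] at hi
    apply Finset.sum_eq_zero
    intro j _
    rw [if_neg]
    simp only [decide_eq_true_eq]
    omega
  · intro i hi
    simp only [Finset.mem_range] at hi
    apply Finset.sum_subset_zero_on_sdiff
    · exact Finset.Ico_subset_Ico_left (by omega)
    · intro j hj
      simp only [Finset.mem_sdiff, Finset.mem_Ico] at hj
      rw [if_neg]
      simp only [decide_eq_true_eq]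
      omega
    · intro j hj
      simp only [Finset.mem_Ico] at hj
      rw [if_pos]
      simp only [decide_eq_true_eq]
      omega

theorem countP_strandList_eq {n : ℕ} {r : ℕ → ℕ → ℕ} {a b : ℕ} (hab : a ≤ b) (hb : b ≤ n) :
    (strandList n r).countP (fun s => decide (s.1 = a ∧ s.2 = b)) = strandCount n r a b := by
  rw [countP_strandList, Finset.sum_eq_single a, Finset.sum_eq_single b]
  · simp
  · intro j _ hj
    simp [hj]
  · intro h
    simp at h
    omega
  · intro i _ hi
    simp [hi]
  · intro h
    simp at h
    omega

theorem mem_strandList {n : ℕ} {r : ℕ → ℕ → ℕ} {s : ℕ × ℕ} (h : s ∈ strandList n r) :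
    s.1 ≤ s.2 ∧ s.2 ≤ n := by
  simp only [strandList, List.mem_flatMap, List.mem_range, List.mem_reverse, List.mem_range'_1,
    List.mem_replicate] at h
  obtain ⟨i, hi, j, hj, -, rfl⟩ := h
  simp only
  omega

/-- This order, earlier starts first and longer strands first among equal starts, is the source of
every geometric property of the left-most diagram used below. -/
theorem pairwise_strandList (n : ℕ) (r : ℕ → ℕ → ℕ) :
    (strandList n r).Pairwise fun s s' => s.1 < s'.1 ∨ s.1 = s'.1 ∧ s'.2 ≤ s.2 := by
  rw [strandList, List.pairwise_flatMap]
  constructor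
  · intro i _
    rw [List.pairwise_flatMap]
    constructor
    · intro j _
      rw [List.pairwise_replicate]
      right; right
      simp
    · rw [List.pairwise_reverse]
      apply List.Pairwise.imp _ List.pairwise_lt_range'
      intro j j' hjj x hx y hy
      rw [(List.mem_replicate.1 hx).2, (List.mem_replicate.1 hy).2]
      right
      exact ⟨rfl, hjj.le⟩
  · apply List.Pairwise.imp _ List.pairwise_lt_range
    intro i i' hii x hx y hy
    simp only [List.mem_flatMap, List.mem_replicate] at hx hy
    obtain ⟨_, _, _, rfl⟩ := hx
    obtain ⟨_, _, _, rfl⟩ := hy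
    exact Or.inl hii

/-- The strand number `t` of the list `L`; beyond the end of the list, a strand that meets no
column. -/
def strandAt (L : List (ℕ × ℕ)) (t : ℕ) : ℕ × ℕ := L.getD t (1, 0)

/-- Strand number `t` of the list `L` meets column `k`. -/
abbrev Meets (L : List (ℕ × ℕ)) (k t : ℕ) : Prop :=
  (strandAt L t).1 ≤ k ∧ k ≤ (strandAt L t).2

theorem strandAt_eq_get {L : List (ℕ × ℕ)} (t : Fin L.length) : strandAt L t = L.get t := by
  simp [strandAt]

theorem Meets.lt_length {L : List (ℕ × ℕ)} {k t : ℕ} (h : Meets L k t) : t < L.length := by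
  by_contra hc
  simp only [Meets, strandAt, List.getD_eq_default _ _ (not_lt.1 hc)] at h
  omega

theorem count_strandAt (L : List (ℕ × ℕ)) (p : ℕ × ℕ → Bool) (hp : p (1, 0) = false) (m : ℕ) :
    Nat.count (fun t => p (strandAt L t) = true) m = (L.take m).countP p := by
  induction m with
  | zero => simp
  | succ m ih =>
    rw [Nat.count_succ, ih, strandAt]
    by_cases h : m < L.length
    · rw [List.take_add_one, List.countP_append, List.getD_eq_getElem _ _ h,
        List.getElem?_eq_getElem h]
      simp [List.countP_singleton]
    · rw [List.getD_eq_default _ _ (not_lt.1 h), List.take_of_length_le (by omega),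
        List.take_of_length_le (by omega)]
      simp [hp]

theorem dotRow_eq_count (L : List (ℕ × ℕ)) (t k : ℕ) : dotRow L t k = Nat.count (Meets L k) t := by
  rw [dotRow, ← count_strandAt L _ (by simp; omega)]
  simp only [decide_eq_true_eq]

theorem strandAt_pairwise {n : ℕ} {r : ℕ → ℕ → ℕ} {t t' : ℕ} (h : t < t')
    (h' : t' < (strandList n r).length) :
    (strandAt (strandList n r) t).1 < (strandAt (strandList n r) t').1 ∨
      (strandAt (strandList n r) t).1 = (strandAt (strandList n r) t').1 ∧
        (strandAt (strandList n r) t').2 ≤ (strandAt (strandList n r) t).2 := by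
  have h1 := List.pairwise_iff_getElem.1 (pairwise_strandList n r) t t' (h.trans h') h' h
  rw [strandAt, strandAt, List.getD_eq_getElem _ _ h', List.getD_eq_getElem _ _ (h.trans h')]
  exact h1

theorem strandAt_snd_le {n : ℕ} {r : ℕ → ℕ → ℕ} {t : ℕ} (h : t < (strandList n r).length) :
    (strandAt (strandList n r) t).1 ≤ (strandAt (strandList n r) t).2 ∧
      (strandAt (strandList n r) t).2 ≤ n := by
  rw [strandAt, List.getD_eq_getElem _ _ h]
  exact mem_strandList (List.getElem_mem h)

/-! ### Strands through a column, the left-most diagram and its product -/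

section strands

variable {n : ℕ} {e : ℕ → ℕ} {r : ℕ → ℕ → ℕ}

theorem IsOrbit.count_meets (hr : IsOrbit n e r) {k : ℕ} (hk : k ≤ n) :
    Nat.count (Meets (strandList n r) k) (strandList n r).length = e k := by
  rw [← dotRow_eq_count, dotRow, List.take_length, hr.countP_strandList le_rfl hk, hr.self_eq hk]

/-- The strand through the dot in row `q` of column `k`. -/
noncomputable def strandOf (n : ℕ) (r : ℕ → ℕ → ℕ) (k q : ℕ) : ℕ :=
  Nat.nth (Meets (strandList n r) k) q

theorem IsOrbit.strandOf_spec (hr : IsOrbit n e r) {k q : ℕ} (hk : k ≤ n) (hq : q < e k) :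
    Meets (strandList n r) k (strandOf n r k q) ∧
      Nat.count (Meets (strandList n r) k) (strandOf n r k q) = q := by
  rw [← hr.count_meets hk] at hq
  exact ⟨(nth_spec hq).1, (nth_spec hq).2.1⟩

theorem IsOrbit.strandOf_lt (hr : IsOrbit n e r) {k q q' : ℕ} (hk : k ≤ n) (hq' : q' < e k)
    (h : q < q') : strandOf n r k q < strandOf n r k q' := by
  rw [← hr.count_meets hk] at hq'
  exact nth_lt_nth_of_lt_count hq' h

theorem strandOf_count {k t : ℕ} (h : Meets (strandList n r) k t) :
    strandOf n r k (Nat.count (Meets (strandList n r) k) t) = t := Nat.nth_count h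

/-- The number of strands through column `k` that meet the previous column. -/
def connCount (n : ℕ) (r : ℕ → ℕ → ℕ) : ℕ → ℕ
  | 0 => 0
  | k + 1 => Nat.count (fun t => Meets (strandList n r) k t ∧ Meets (strandList n r) (k + 1) t)
      (strandList n r).length

theorem IsOrbit.connCount_succ (hr : IsOrbit n e r) {k : ℕ} (hk : k + 1 ≤ n) :
    connCount n r (k + 1) = r k (k + 1) := by
  have h := count_strandAt (strandList n r) (fun s => decide (s.1 ≤ k ∧ k + 1 ≤ s.2))
    (by simp) (strandList n r).length
  rw [List.take_length, hr.countP_strandList (by omega) hk] at h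
  rw [connCount, ← h]
  congr 1
  funext t
  simp only [decide_eq_true_eq, eq_iff_iff]
  omega

/-- Strands that start earlier are above those that start later. -/
theorem count_and_meets {k t : ℕ} (h : Meets (strandList n r) k t) :
    Nat.count (fun t => Meets (strandList n r) k t ∧ Meets (strandList n r) (k + 1) t) t =
      Nat.count (Meets (strandList n r) (k + 1)) t := by
  rw [Nat.count_eq_card_filter_range, Nat.count_eq_card_filter_range]
  congr 1
  apply Finset.filter_congr
  intro t' ht'
  have := strandAt_pairwise (Finset.mem_range.1 ht') h.lt_length
  simp only [Meets] at h ⊢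
  omega

theorem IsOrbit.connCount_le (hr : IsOrbit n e r) {k : ℕ} (hk : k ≤ n) : connCount n r k ≤ e k := by
  rcases k with _ | k
  · exact Nat.zero_le _
  · rw [← hr.count_meets hk, connCount]
    exact Nat.count_mono_left fun _ _ h => h.2

/-- Strands that start earlier lie higher, so the dots of column `k` connected to the left come
first and the starting points of strands fill the bottom. -/
theorem IsOrbit.start_eq_iff (hr : IsOrbit n e r) {k q : ℕ} (hk : k ≤ n) (hq : q < e k) :
    (strandAt (strandList n r) (strandOf n r k q)).1 = k ↔ connCount n r k ≤ q := by
  obtain ⟨h1, h2⟩ := hr.strandOf_spec hk hq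
  rcases k with _ | k
  · simp only [connCount, Nat.zero_le, iff_true]
    simp only [Meets] at h1
    omega
  · set t := strandOf n r (k + 1) q with ht
    by_cases hm : Meets (strandList n r) k t
    · have h3 : q < connCount n r (k + 1) := by
        rw [← h2, ← count_and_meets hm, connCount]
        exact Nat.count_strict_mono (p := fun t => Meets (strandList n r) k t ∧
          Meets (strandList n r) (k + 1) t) ⟨hm, h1⟩ hm.lt_length
      simp only [Meets] at hm
      omega
    · have h3 : connCount n r (k + 1) ≤ q := by
        rw [connCount, ← h2]
        have hle : Nat.count
            (fun t => Meets (strandList n r) k t ∧ Meets (strandList n r) (k + 1) t)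
            (strandList n r).length ≤ Nat.count (fun t => Meets (strandList n r) k t ∧
              Meets (strandList n r) (k + 1) t) t := by
          rw [Nat.count_eq_card_filter_range, Nat.count_eq_card_filter_range]
          apply Finset.card_le_card
          intro t' ht'
          simp only [Finset.mem_filter, Finset.mem_range] at ht' ⊢
          refine ⟨?_, ht'.2⟩
          by_contra hc
          have hne : t ≠ t' := by
            intro h
            exact hm (h ▸ ht'.2.1)
          have := strandAt_pairwise (n := n) (r := r) (t := t) (t' := t') (by omega) ht'.1
          simp only [Meets] at h1 hm ht'
          omega
        exact hle.trans (Nat.count_mono_left fun _ _ h => h.2)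
      simp only [h3, iff_true]
      simp only [Meets] at hm h1
      omega

/-- The dots of column `k` whose strands continue to column `k + 1`. -/
abbrev Continues (n : ℕ) (r : ℕ → ℕ → ℕ) (k p : ℕ) : Prop :=
  Meets (strandList n r) (k + 1) (strandOf n r k p)

theorem IsOrbit.count_continues (hr : IsOrbit n e r) {k : ℕ} (hk : k ≤ n) :
    Nat.count (Continues n r k) (e k) = connCount n r (k + 1) := by
  rw [← hr.count_meets hk]
  exact count_nth_comp (Meets (strandList n r) k) (Meets (strandList n r) (k + 1)) _

/-- The factors of the left-most lace diagram. -/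
noncomputable def leftmost (hr : IsOrbit n e r) (j : Fin n) : Perm ℕ :=
  grass (e (j + 1)) (e j) (Continues n r j)
    (by rw [hr.count_continues j.isLt.le]; exact hr.connCount_le j.isLt)

theorem isLaceDiagram_leftmost (hr : IsOrbit n e r) : IsLaceDiagram n e (leftmost hr) :=
  fun _ => isPartialPerm_grass

theorem isNormal_leftmost (hr : IsOrbit n e r) : IsNormal n e (leftmost hr) :=
  fun _ _ hk => grass_lt_of_lt (Nat.lt_succ_self _) hk

/-- Strands keep their order between neighbouring columns, so dot `q` lies on the same strand as the
continuing dot number `q` of the previous column. -/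
theorem leftmost_of_lt (hr : IsOrbit n e r) (j : Fin n) {q : ℕ} (hq : q < connCount n r (j + 1)) :
    leftmost hr j q < e j ∧ Continues n r j (leftmost hr j q) ∧
      strandOf n r j (leftmost hr j q) = strandOf n r (j + 1) q := by
  have hq' : q < Nat.count (Continues n r j) (e j) := by rwa [hr.count_continues j.isLt.le]
  rw [leftmost, grass_apply_of_lt_count hq']
  obtain ⟨h1, h2, h3⟩ := nth_spec hq'
  refine ⟨h3, h1, ?_⟩
  set p := Nat.nth (Continues n r j) q with hp
  obtain ⟨h4, h5⟩ := hr.strandOf_spec j.isLt.le h3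
  have h6 := count_nth_comp (Meets (strandList n r) j) (Meets (strandList n r) (j + 1))
    (strandOf n r j p)
  rw [h5, count_and_meets h4] at h6
  have h7 : Nat.count (Meets (strandList n r) (j + 1)) (strandOf n r j p) = q := h6.symm.trans h2
  rw [← h7, strandOf_count h1]

theorem leftmost_of_ge (hr : IsOrbit n e r) (j : Fin n) {q : ℕ} (hq : connCount n r (j + 1) ≤ q)
    (hq' : q < e (j + 1)) : leftmost hr j q = e j + (q - connCount n r (j + 1)) := by
  rw [leftmost, grass_apply_of_count_le (by rwa [hr.count_continues j.isLt.le]) hq',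
    hr.count_continues j.isLt.le]

theorem leftmost_terminal (hr : IsOrbit n e r) (j : Fin n) {y : ℕ}
    (hy : y + connCount n r (j + 1) < e j) :
    leftmost hr j (e (j + 1) + y) < e j ∧ ¬ Continues n r j (leftmost hr j (e (j + 1) + y)) := by
  have hc := hr.count_continues j.isLt.le
  have hcc := count_add_count_not (Continues n r j) (e j)
  rw [leftmost, grass_apply_of_le (by omega) (by omega), Nat.add_sub_cancel_left]
  have := nth_spec (D := fun x => ¬ Continues n r j x) (b := e j) (q := y) (by omega)
  exact ⟨this.2.2, this.1⟩

theorem leftmost_virtual (hr : IsOrbit n e r) (j : Fin n) {y : ℕ}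
    (hy : e j ≤ y + connCount n r (j + 1)) : leftmost hr j (e (j + 1) + y) = e (j + 1) + y := by
  have hc := hr.count_continues j.isLt.le
  rw [leftmost, grass_apply_of_ge (by omega)]

theorem leftmostConnected_iff {i q p : ℕ} : LeftmostConnected n r i q p ↔
    ∃ t, Meets (strandList n r) i t ∧ Meets (strandList n r) (i + 1) t ∧
      q = Nat.count (Meets (strandList n r) (i + 1)) t ∧
      p = Nat.count (Meets (strandList n r) i) t := by
  constructor
  · rintro ⟨t, h1, h2, h3, h4⟩
    rw [← strandAt_eq_get] at h1 h2
    refine ⟨t, ⟨h1, by omega⟩, ⟨by omega, h2⟩, ?_, ?_⟩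
    · rw [h3, dotRow_eq_count]
    · rw [h4, dotRow_eq_count]
  · rintro ⟨t, h1, h2, h3, h4⟩
    refine ⟨⟨t, h1.lt_length⟩, ?_, ?_, ?_, ?_⟩
    · rw [← strandAt_eq_get]; exact h1.1
    · rw [← strandAt_eq_get]; exact h2.2
    · rw [h3, dotRow_eq_count]
    · rw [h4, dotRow_eq_count]

theorem isLeftmost_leftmost (hr : IsOrbit n e r) : IsLeftmost n e r (leftmost hr) := by
  refine ⟨isLaceDiagram_leftmost hr, fun i q p hq hp => ?_⟩
  rw [leftmostConnected_iff]
  constructor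
  · intro h
    have hlt : q < connCount n r (i + 1) := by
      by_contra hc
      rw [leftmost_of_ge hr i (not_lt.1 hc) hq] at h
      omega
    obtain ⟨-, h2, h3⟩ := leftmost_of_lt hr i hlt
    rw [h] at h2 h3
    obtain ⟨h4, h5⟩ := hr.strandOf_spec i.isLt.le hp
    refine ⟨strandOf n r i p, h4, h2, ?_, h5.symm⟩
    rw [h3, (hr.strandOf_spec i.isLt hq).2]
  · rintro ⟨t, h1, h2, rfl, rfl⟩
    have hlt : Nat.count (Meets (strandList n r) (i + 1)) t < connCount n r (i + 1) := by
      rw [← count_and_meets h1, connCount]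
      exact Nat.count_strict_mono (p := fun t => Meets (strandList n r) i t ∧
        Meets (strandList n r) (i + 1) t) ⟨h1, h2⟩ h1.lt_length
    obtain ⟨h3, -, h5⟩ := leftmost_of_lt hr i hlt
    rw [strandOf_count h2] at h5
    rw [← (hr.strandOf_spec i.isLt.le h3).2, h5]

theorem IsLeftmost.unique {w w' : Fin n → Perm ℕ} (h : IsLeftmost n e r w)
    (h' : IsLeftmost n e r w') : w = w' := by
  funext i
  exact (h.1 i).ext (h'.1 i) fun q p hq hp => (h.2 i q p hq hp).trans (h'.2 i q p hq hp).symm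

/-- The column in which the wire that enters column `k` in position `t` leaves: wires that
never meet a dot leave one column earlier. -/
noncomputable def endLabel (n : ℕ) (e : ℕ → ℕ) (r : ℕ → ℕ → ℕ) (k t : ℕ) : ℕ :=
  if connCount n r k + t < e k then
    (strandAt (strandList n r) (strandOf n r k (connCount n r k + t))).2
  -- These wires give the entries in block row `k - 1` and block column `k`. For `k = 0` this branch
  -- needs `t ≥ e 0` and is irrelevant.
  else k - 1

theorem IsOrbit.le_end (hr : IsOrbit n e r) {k t : ℕ} (hk : k ≤ n)
    (h : connCount n r k + t < e k) : k ≤ endLabel n e r k t := by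
  rw [endLabel, if_pos h]
  exact (hr.strandOf_spec hk h).1.2

theorem IsOrbit.endLabel_le (hr : IsOrbit n e r) {k t t' : ℕ} (hk : k ≤ n) (h : t < t') :
    endLabel n e r k t' ≤ endLabel n e r k t := by
  by_cases h1 : connCount n r k + t' < e k
  · have h2 : connCount n r k + t < e k := by omega
    rw [endLabel, endLabel, if_pos h1, if_pos h2]
    have h3 := strandAt_pairwise (hr.strandOf_lt hk h1
      (show connCount n r k + t < connCount n r k + t' by omega))
      (hr.strandOf_spec hk h1).1.lt_length
    rw [(hr.start_eq_iff hk h1).2 (by omega), (hr.start_eq_iff hk h2).2 (by omega)] at h3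
    omega
  · by_cases h2 : connCount n r k + t < e k
    · have := hr.le_end hk h2
      rw [endLabel, if_neg h1]
      omega
    · rw [endLabel, endLabel, if_neg h1, if_neg h2]

/-- The strands starting in column `i` are those through its dots from `connCount` on, which match
the first entering wires; the other `connCount` wires, `r (i - 1) i` in number when `i > 0`, carry
the label `i - 1`. -/
theorem IsOrbit.card_endLabel (hr : IsOrbit n e r) {i j : ℕ} (hi : i ≤ n) (hj : j ≤ n) :
    ((Finset.range (e i)).filter fun t => endLabel n e r i t = j).card =
      if i ≤ j then strandCount n r i j else if i = j + 1 then r j i else 0 := by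
  have hle := hr.connCount_le hi
  split_ifs with h1 h2
  · have hcount : Nat.count (fun q => (strandAt (strandList n r) (strandOf n r i q)).1 = i ∧
        (strandAt (strandList n r) (strandOf n r i q)).2 = j) (e i) = strandCount n r i j := by
      have h3 := count_nth_comp (Meets (strandList n r) i)
        (fun t => (strandAt (strandList n r) t).1 = i ∧ (strandAt (strandList n r) t).2 = j)
        (strandList n r).length
      rw [hr.count_meets hi] at h3
      refine h3.trans ?_
      have h4 := count_strandAt (strandList n r) (fun s => decide (s.1 = i ∧ s.2 = j))
        (by simp; omega) (strandList n r).length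
      rw [List.take_length, countP_strandList_eq h1 hj] at h4
      rw [← h4]
      congr 1
      funext t
      simp only [decide_eq_true_eq, eq_iff_iff, Meets]
      omega
    obtain ⟨m, hm⟩ := Nat.exists_eq_add_of_le hle
    rw [← hcount]
    nth_rw 2 [hm]
    rw [Nat.count_add, (Nat.count_iff_forall_not (n := connCount n r i)).2, zero_add,
      Nat.count_eq_card_filter_range]
    · congr 1
      ext t
      rw [Finset.mem_filter, Finset.mem_filter, Finset.mem_range, Finset.mem_range, endLabel]
      by_cases h3 : connCount n r i + t < e i
      · rw [if_pos h3, (hr.start_eq_iff hi h3)]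
        constructor
        · exact fun h => ⟨by omega, by omega, h.2⟩
        · exact fun h => ⟨by omega, h.2.2⟩
      · rw [if_neg h3]
        by_cases hij : i = 0
        · subst hij
          simp only [connCount] at h3 hm
          omega
        · omega
    · intro q hq h
      have := (hr.start_eq_iff hi (hq.trans_le hle)).1 h.1
      omega
  · subst h2
    rw [← hr.connCount_succ hi]
    have : ((Finset.range (e (j + 1))).filter fun t => endLabel n e r (j + 1) t = j) =
        Finset.Ico (e (j + 1) - connCount n r (j + 1)) (e (j + 1)) := by
      ext t
      simp only [Finset.mem_filter, Finset.mem_range, Finset.mem_Ico]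
      by_cases h3 : connCount n r (j + 1) + t < e (j + 1)
      · have := hr.le_end hi h3
        omega
      · rw [endLabel, if_neg h3]
        omega
    rw [this, Nat.card_Ico]
    omega
  · rw [Finset.card_eq_zero, Finset.filter_eq_empty_iff]
    intro t _
    by_cases h3 : connCount n r i + t < e i
    · have := hr.le_end hi h3
      omega
    · rw [endLabel, if_neg h3]
      omega

/-- The product of the left-most lace diagram is the Zelevinsky permutation. -/
theorem exists_isZelevinsky_leftmost (hr : IsOrbit n e r) :
    ∃ v : Perm (Fin (totalDim n e)), IsZelevinsky n e r v ∧
      ∀ p : Fin (totalDim n e),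
        Hecke.perm (factorProd n e (leftmost hr)) (Fin.rev p : Fin (totalDim n e)) =
          (Fin.rev (v p) : ℕ) := by
  have hl := isLaceDiagram_leftmost hr
  have hn := isNormal_leftmost hr
  have hend : ∀ (j : Fin n) p, p < e j → ¬ Continues n r j p →
      (strandAt (strandList n r) (strandOf n r j p)).2 = j := by
    intro j p hp hc
    have := (hr.strandOf_spec j.isLt.le hp).1
    simp only [Continues, Meets] at hc this
    omega
  refine exists_isZelevinsky (fixesOutside_factorProd hl.inRange) (endLabel n e r) ?_
    (fun j k k' hj hk hk' => hn.factorProd_lt hl hj hk hk')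
    (fun i t t' hi ht _ => hr.endLabel_le hi ht) fun i j hi hj => hr.card_endLabel hi hj
  intro j i k t hj hi hk ht hz
  -- A dot is labelled by the final column of its strand, and a wire leaving at column `j` has label
  -- `j`.
  have hlabel := hn.factorProd_label hl.inRange
    (δ := fun k q => (strandAt (strandList n r) (strandOf n r k q)).2) (E := endLabel n e r)
    (lab := id) ?_ ?_ ?_ ?_ ?_ hj hk hz
  · obtain ⟨h1, h2⟩ := hlabel
    rcases i with _ | i
    · simp only [Finset.range_zero, Finset.sum_empty, zero_add] at h1
      rw [endLabel, if_pos (by simpa [connCount] using ht)]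
      simpa [connCount] using h1 ht
    · have := h2 i (by omega) (by omega) (by rw [Finset.sum_range_succ _ (i + 1)]; omega)
      rwa [Nat.add_sub_cancel_left] at this
  · intro j y hy hlt
    have hc : y < connCount n r (j + 1) := by
      by_contra hc
      rw [leftmost_of_ge hr j (not_lt.1 hc) hy] at hlt
      omega
    rw [(leftmost_of_lt hr j hc).2.2]
  · intro j y hy hge
    have hc : connCount n r (j + 1) ≤ y := by
      by_contra hc
      have := (leftmost_of_lt hr j (not_le.1 hc)).1
      omega
    rw [leftmost_of_ge hr j hc hy, Nat.add_sub_cancel_left, endLabel, if_pos (by omega),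
      Nat.add_sub_cancel' hc]
  · intro j y hy hlt
    have hc : y + connCount n r (j + 1) < e j := by
      by_contra hc
      rw [leftmost_virtual hr j (not_lt.1 hc)] at hlt
      have := hr.connCount_le (k := j + 1) j.isLt
      omega
    exact hend j _ hlt (leftmost_terminal hr j hc).2
  · intro j y hy hge
    have hc : e j ≤ y + connCount n r (j + 1) := by
      by_contra hc
      have := (leftmost_terminal hr j (not_le.1 hc)).1
      omega
    have := hr.connCount_le (k := j + 1) j.isLt
    rw [leftmost_virtual hr j hc, endLabel, if_neg (by omega)]
    rfl
  · intro y hy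
    have h3 := (hr.strandOf_spec le_rfl hy).1
    have h4 := (strandAt_snd_le h3.lt_length).2
    simp only [Meets, id] at h3 ⊢
    omega

end strands

/-! ### KMS-factorizations as a fibre of the product map -/

theorem isKMSFactorization_iff {n : ℕ} {e : ℕ → ℕ} {r : ℕ → ℕ → ℕ} {w : Fin n → Perm ℕ} :
    IsKMSFactorization n e r w ↔ InRange n e w ∧
      ∃ v : Perm (Fin (totalDim n e)), IsZelevinsky n e r v ∧
        ∀ p : Fin (totalDim n e), Hecke.perm (factorProd n e w) (Fin.rev p : Fin (totalDim n e)) =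
          (Fin.rev (v p) : ℕ) := by
  have hrange : InRange n e w ↔ ∀ j : Fin n, ∀ k : ℕ, e j + e (j + 1) ≤ k → w j k = k :=
    ⟨fun h j k hk => h j k (Or.inr hk), fun h j k hk => h j k (by omega)⟩
  rw [IsKMSFactorization, ← hrange]
  apply and_congr_right
  intro hw
  constructor
  · rintro ⟨v, z, hv, hz, h⟩
    rw [isHeckeProduct_factorList hw.finSupp] at hz
    exact ⟨v, hv, by rwa [hz]⟩
  · rintro ⟨v, hv, h⟩
    exact ⟨v, _, hv, (isHeckeProduct_factorList hw.finSupp _).2 rfl, h⟩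

/-- A factorization moves to a normal sequence with the same product, which can only be the
left-most diagram; since moves are reversible, the path may be run backwards. The converse is
invariance of the product. -/
theorem isKMSFactorization_iff_reflTransGen {n : ℕ} {e : ℕ → ℕ} {r : ℕ → ℕ → ℕ}
    (hr : IsOrbit n e r) (w : Fin n → Perm ℕ) :
    IsKMSFactorization n e r w ↔ Relation.ReflTransGen (KMove n e) (leftmost hr) w := by
  obtain ⟨v, hv, hz⟩ := exists_isZelevinsky_leftmost hr
  have hr0 := (isLaceDiagram_leftmost hr).inRange
  rw [isKMSFactorization_iff]
  constructor
  · rintro ⟨hw, v', hv', hz'⟩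
    obtain ⟨w', hm, hw', hn', hp⟩ := exists_isNormal hw (hv'.blockMono hz')
    have heq : factorProd n e w' = factorProd n e (leftmost hr) := by
      rw [hp]
      apply Hecke.perm_injective
      apply Equiv.ext
      intro x
      by_cases hx : x < totalDim n e
      · have h1 := hz (Fin.rev ⟨x, hx⟩)
        have h2 := hz' (Fin.rev ⟨x, hx⟩)
        rw [Fin.rev_rev] at h1 h2
        rw [h1, h2, hv.unique hv']
      · rw [fixesOutside_factorProd hw x (by omega), fixesOutside_factorProd hr0 x (by omega)]
    rw [hn'.eq_of_factorProd_eq hw' hr0 (isNormal_leftmost hr) heq] at hm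
    have : Std.Symm (KMove n e) := ⟨fun _ _ h => h.symm⟩
    exact Std.Symm.symm _ _ hm
  · intro h
    have key : InRange n e w ∧ factorProd n e w = factorProd n e (leftmost hr) := by
      induction h with
      | refl => exact ⟨hr0, rfl⟩
      | tail _ hm ih => exact ⟨hm.2.1.inRange, hm.factorProd_eq.symm.trans ih.2⟩
    exact ⟨key.1, v, hv, by rwa [key.2]⟩

end KMS

theorem theorem5p1 (n : ℕ) (e : ℕ → ℕ) (r : ℕ → ℕ → ℕ) (hr : KMS.IsOrbit n e r) :
    (∃! w₀ : Fin n → Equiv.Perm ℕ, KMS.IsLeftmost n e r w₀) ∧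
      ∀ w₀ : Fin n → Equiv.Perm ℕ, KMS.IsLeftmost n e r w₀ →
        ∀ w : Fin n → Equiv.Perm ℕ,
          KMS.IsKMSFactorization n e r w ↔ Relation.ReflTransGen (KMS.KMove n e) w₀ w := by
  refine ⟨⟨KMS.leftmost hr, KMS.isLeftmost_leftmost hr,
    fun w hw => hw.unique (KMS.isLeftmost_leftmost hr)⟩, fun w₀ hw₀ w => ?_⟩
  rw [hw₀.unique (KMS.isLeftmost_leftmost hr)]
  exact KMS.isKMSFactorization_iff_reflTransGen hr w
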